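/- Let $V:[0,1]\to\mathbb{R}$ be continuous and strictly positive. Let $\mathcal{P}_1$ be the set of strictly positive functions $v\in H^1(0,1)$ (continuous representatives on $[0,1]$) with $\int_0^1 v\,dx=1$, with the topology of the $H^1$ norm, and let $\mathcal{F}_1$ be the set of continuous maps $\mathcal{P}_1\to\mathbb{R}$. Consider the nonlinear heat equation $$\partial_t v=\partial_{xx}^2v-Vv+\Big(\int_0^1V(\xi)v(t,\xi)\,d\xi\Big)v,\qquad \partial_xv(t,0)=\partial_xv(t,1)=0,\qquad v(0,\cdot)=v_0 .$$ A weak solution on $[0,T]$ is $v\in C([0,T];L^2(0,1))$ with $v(0)=v_0$ such that, for every $\varphi\in C^2([0,1])$ with $\varphi'(0)=\varphi'(1)=0$ and every $t\in[0,T]$, $$\frac{d}{dt}\int_0^1v\varphi\,dx=\int_0^1v(\varphi''-V\varphi)\,dx+\Big(\int_0^1Vv\,dx\Big)\int_0^1v\varphi\,dx .$$ Let $(e_n)_{n\ge0}$ be a complete orthonormal system of $L^2(0,1)$ of eigenfunctions, $-e_n''+Ve_n=\mu_ne_n$ on $[0,1]$, $e_n'(0)=e_n'(1)=0$, with $\mu_0\le\mu_1\le\cdots$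 and the sign of $e_0$ chosen so that $\int_0^1e_0\,dx\ge0$. Let $c_n(v)=\int_0^1e_n v\,dx$ for $v\in\mathcal{P}_1$. Then: 1. For every $v_0\in\mathcal{P}_1$ and $T\geq 0$ the equation has exactly one weak solution on $[0,T]$, and its values lie in $\mathcal{P}_1$. Hence there is a flow $\Phi^t_{\mathcal N}:\mathcal{P}_1\to\mathcal{P}_1$, $t\ge0$, and the Koopman operator $(\mathcal{K}^t_{\mathcal N}\phi)(v_0)=\phi(\Phi^t_{\mathcal N}(v_0))$ maps $\mathcal{F}_1$ to $\mathcal{F}_1$. Moreover $c_0>0$ on $\mathcal{P}_1$. 2. For every $q\ge0$, $c_q/c_0$ is a nonzero element of $\mathcal{F}_1$ and, for all $t\ge0$, $$\mathcal{K}^t_{\mathcal N}\Big(\frac{c_q}{c_0}\Big)=e^{-(\mu_q-\mu_0)t}\,\frac{c_q}{c_0}.$$ 3. For every $m\ge0$ and $\nu=(q_0,q_1,\dots,q_m)\in\mathbb{N}\times(\mathbb{N}\setminus\{0\})^m$, with $$\lambda_\nu=\sum_{i=0}^m(\mu_{q_i}-\mu_0),\qquad \psi_\nu=\prod_{i=0}^m\frac{c_{q_i}}{c_0},$$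 $\psi_\nu$ is a nonzero element of $\mathcal{F}_1$ and $\mathcal{K}^t_{\mathcal N}\psi_\nu=e^{-\lambda_\nu t}\psi_\nu$ for all $t\ge0$. That is, $e^{-\lambda_\nu t}$ is an eigenvalue of $\mathcal{K}^t_{\mathcal N}$ with eigenfunctional $\psi_\nu$. -/

import Mathlib

open Set MeasureTheory
open scoped ContDiff unitInterval

noncomputable section

/-- The Hilbert space `L²([0,1])` (Lebesgue measure). -/
abbrev L2I : Type := Lp ℝ 2 (volume : Measure I)

/-- `g ∈ L²([0,1])` is the weak derivative of the continuous function `v` on `[0,1]`. -/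
def IsWeakDeriv (v : C(I, ℝ)) (g : L2I) : Prop :=
  ∀ φ : ℝ → ℝ, ContDiff ℝ ∞ φ → HasCompactSupport φ → tsupport φ ⊆ Ioo (0 : ℝ) 1 →
    ∫ x : I, v x * deriv φ (x : ℝ) = -∫ x : I, g x * φ (x : ℝ)

/-- The set `𝒫₁`: strictly positive functions on `[0,1]`, in `H¹` (a function of `H¹(0,1)` is
identified with its continuous representative), with integral one. -/
@[ext]
structure P1 where
  toC : C(I, ℝ)
  exists_weakDeriv : ∃ g : L2I, IsWeakDeriv toC g
  pos : ∀ x : I, 0 < toC x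
  integral_eq_one : ∫ x : I, toC x = 1

/-- The class in `L²([0,1])` of an element of `𝒫₁`. -/
def P1.toL2 (v : P1) : L2I := ContinuousMap.toLp 2 (volume : Measure I) ℝ v.toC

/-- The weak derivative of an element of `𝒫₁`. -/
def P1.weakDeriv (v : P1) : L2I := v.exists_weakDeriv.choose

/-- The topology of the `H¹` norm on `𝒫₁`: convergence in `L²` of the function and of its weak
derivative. -/
instance : TopologicalSpace P1 :=
  TopologicalSpace.induced (fun v : P1 => (v.toL2, v.weakDeriv)) inferInstance

/-- Test functions: `φ ∈ C²([0,1])` with first and second derivatives `φ₁`, `φ₂`, and with the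
Neumann conditions `φ₁(0) = φ₁(1) = 0`. -/
structure IsNeumannTest (φ φ₁ φ₂ : ℝ → ℝ) : Prop where
  hasDeriv₁ : ∀ x ∈ Icc (0 : ℝ) 1, HasDerivWithinAt φ (φ₁ x) (Icc 0 1) x
  hasDeriv₂ : ∀ x ∈ Icc (0 : ℝ) 1, HasDerivWithinAt φ₁ (φ₂ x) (Icc 0 1) x
  continuousOn : ContinuousOn φ₂ (Icc 0 1)
  left : φ₁ 0 = 0
  right : φ₁ 1 = 0

/-- `u ∈ C([0,T]; L²)` is a weak solution on `[0,T]` of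
`∂ₜu = ∂ₓₓu - V u + (∫₀¹ V(ξ) u(t,ξ) dξ) u`, `∂ₓu(t,0) = ∂ₓu(t,1) = 0`, `u(0,·) = v₀`.
The equation is tested against all `φ ∈ C²([0,1])` with `φ'(0) = φ'(1) = 0`; the Neumann
condition on `u` is contained in this choice of test functions. -/
structure IsWeakSolution (V : C(I, ℝ)) (T : ℝ) (v₀ : L2I) (u : ℝ → L2I) : Prop where
  continuousOn : ContinuousOn u (Icc 0 T)
  initial : u 0 = v₀
  weak_eq : ∀ φ φ₁ φ₂ : ℝ → ℝ, IsNeumannTest φ φ₁ φ₂ → ∀ t ∈ Icc (0 : ℝ) T,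
    HasDerivWithinAt (fun s : ℝ => ∫ x : I, u s x * φ x)
      ((∫ x : I, u t x * (φ₂ x - V x * φ x)) +
        (∫ y : I, V y * u t y) * (∫ x : I, u t x * φ x))
      (Icc 0 T) t

open Classical in
/-- The nonlinear heat flow `Φᵗ` on `𝒫₁`: `Φᵗ(v₀)` is the value at time `t` of the solution with
initial value `v₀`. (The default value `v₀` is never used for `t ≥ 0` when the equation is
well posed in `𝒫₁`.) -/
def nonlinearHeatFlow (V : C(I, ℝ)) (t : ℝ) (v₀ : P1) : P1 :=
  if h : ∃ w : P1, ∃ u : ℝ → L2I, IsWeakSolution V t v₀.toL2 u ∧ u t = w.toL2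
  then h.choose else v₀

/-- The observables: maps `𝒫₁ → ℝ` that are continuous for the `H¹` norm. -/
def observables : Set (P1 → ℝ) := {ϕ | Continuous ϕ}

/-- The Koopman operator `(𝒦ᵗ ϕ)(v₀) = ϕ(Φᵗ(v₀))`. -/
def koopman (V : C(I, ℝ)) (t : ℝ) : (P1 → ℝ) →ₗ[ℝ] (P1 → ℝ) :=
  LinearMap.funLeft ℝ ℝ (nonlinearHeatFlow V t)

/-- `ϕ` is an eigen-observable of the Koopman operators, with eigenvalue `exp (-rate * t)` for
`𝒦ᵗ`, for all `t ≥ 0`. (`HasEigenvector` includes `ϕ ≠ 0`.) -/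
def IsKoopmanEigenfunctional (V : C(I, ℝ)) (rate : ℝ) (ϕ : P1 → ℝ) : Prop :=
  ϕ ∈ observables ∧
    ∀ t : ℝ, 0 ≤ t → Module.End.HasEigenvector (koopman V t) (Real.exp (-(rate * t))) ϕ

/-- `f` satisfies `f'' - V f = -κ f` on `[0,1]` and `f'(0) = f'(1) = 0`. -/
def IsNeumannEigenfunction (V : C(I, ℝ)) (κ : ℝ) (f : ℝ → ℝ) : Prop :=
  ∃ f₁ : ℝ → ℝ,
    (∀ x : I, HasDerivWithinAt f (f₁ x) (Icc 0 1) x) ∧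
    (∀ x : I, HasDerivWithinAt f₁ (V x * f x - κ * f x) (Icc 0 1) x) ∧
    f₁ 0 = 0 ∧ f₁ 1 = 0

/-- `(e n)` is a complete orthonormal system of `L²([0,1])` made of Neumann eigenfunctions of
`-∂ₓₓ + V`, with eigenvalues `κ n` listed in nondecreasing order. The last field only fixes the
sign of `e 0`. -/
structure IsNeumannEigenbasis (V : C(I, ℝ)) (κ : ℕ → ℝ) (e : ℕ → ℝ → ℝ) : Prop where
  eigen : ∀ n, IsNeumannEigenfunction V (κ n) (e n)
  mono : Monotone κ
  orthonormal : ∀ m n, ∫ x : I, e m x * e n x = if m = n then 1 else 0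
  complete : ∀ f : L2I, (∀ n, ∫ x : I, e n x * f x = 0) → f = 0
  sign : 0 ≤ ∫ x : I, e 0 x

/-- The functionals `c_n(v) = ∫₀¹ e_n v`. -/
def coeff (e : ℕ → ℝ → ℝ) (n : ℕ) (v : P1) : ℝ := ∫ x : I, e n x * v.toC x

/-- `ψ_ν = ∏_{i=0}^m c_{q_i} / c_0` for `ν = (q_0, …, q_m)`. -/
def psi (e : ℕ → ℝ → ℝ) {m : ℕ} (ν : Fin (m + 1) → ℕ) (v : P1) : ℝ :=
  ∏ i, (coeff e (ν i) v / coeff e 0 v)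

/-- `λ_ν = ∑_{i=0}^m (μ_{q_i} - μ_0)` for `ν = (q_0, …, q_m)`. -/
def rateOf (κ : ℕ → ℝ) {m : ℕ} (ν : Fin (m + 1) → ℕ) : ℝ :=
  ∑ i, (κ (ν i) - κ 0)

end

noncomputable section

open Filter Topology

/-! The nonlinear equation is a normalized linear one. Let `S(t) = ∑ exp(-κ n t) c_n(·) e_n` be the
semigroup of `A = ∂ₓₓ - V` with Neumann conditions. The mass of `S(t)v₀` has derivative `-∫ V
S(t)v₀`, so dividing by it produces exactly the quadratic term, and `S(t)v₀ / ∫ S(t)v₀` is a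
solution (`isWeakSolution_sol`). Conversely, testing any weak solution against `e n` gives `c_n' =
(-κ n + ρ) c_n` with the same scalar `ρ = ∫ V u` for all `n`. Hence `c_n(u(t)) = exp(P t) exp(-κ n
t) c_n(v₀)`, and testing against `1` fixes `exp(P t)` (`eq_sol_of_isWeakSolution`). The common
factor cancels in `c_q / c_0` (`coeff_flow_div`), and composition with the flow respects products,
so rates add up in `ψ_ν`.

The spectral input is the single inequality `φ(x)² ≤ C ⟨-Aφ, φ⟩` (`exists_sq_le`). On finite
combinations of eigenfunctions it yields `κ n > 0`, the bound `e n x ^ 2 ≤ C κ n` and `∑ 1/κ n < ∞`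
(`exists_bound`), which is enough for every series to converge.

Positivity comes from the maximum principle for Neumann test functions, extended to continuous data
by density (`le_heat`). The smallest eigenvalue is simple, so `exp(κ 0 t) S(t)φ → c_0(φ) e_0`; this
makes the ground state nonnegative and `c_0` positive on `P1`. Finally, a small perturbation of the
constant `1` has finitely many prescribed coefficients nonzero (`exists_coeff_ne_zero`), so no `ψ_ν`
vanishes identically. -/

lemma integral_unitInterval_coe (f : ℝ → ℝ) : ∫ x : I, f x = ∫ x in (0 : ℝ)..1, f x := by
  rw [integral_subtype measurableSet_Icc f, intervalIntegral.integral_of_le zero_le_one,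
    integral_Icc_eq_integral_Ioc]

lemma integral_eq_sub_of_hasDerivWithinAt_Icc {a b : ℝ} (hab : a ≤ b) {f f' : ℝ → ℝ}
    (h : ∀ x ∈ Icc a b, HasDerivWithinAt f (f' x) (Icc a b) x) (hc : ContinuousOn f' (Icc a b)) :
    ∫ x in a..b, f' x = f b - f a := by
  refine intervalIntegral.integral_eq_sub_of_hasDerivAt_of_le hab
    (fun x hx => (h x hx).continuousWithinAt)
    (fun x hx => (h x (Ioo_subset_Icc_self hx)).hasDerivAt (Icc_mem_nhds hx.1 hx.2)) ?_
  exact (uIcc_of_le hab ▸ hc).intervalIntegrable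

/-- Termwise differentiation of a series on a compact interval, with one-sided derivatives at the
end points. -/
lemma hasDerivWithinAt_tsum_Icc {a b : ℝ} {f f' : ℕ → ℝ → ℝ} {u : ℕ → ℝ} (hu : Summable u)
    (hf : ∀ n, ∀ x ∈ Icc a b, HasDerivWithinAt (f n) (f' n x) (Icc a b) x)
    (hc : ∀ n, ContinuousOn (f' n) (Icc a b)) (hb : ∀ n, ∀ x ∈ Icc a b, |f' n x| ≤ u n)
    (hs : Summable fun n => f n a) {x : ℝ} (hx : x ∈ Icc a b) :
    HasDerivWithinAt (fun y => ∑' n, f n y) (∑' n, f' n x) (Icc a b) x := by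
  have hab : a ≤ b := hx.1.trans hx.2
  -- Extending the derivatives continuously to the line and integrating gives globally
  -- differentiable functions that agree with `f n` on the interval, so that `hasDerivAt_tsum`
  -- applies.
  set g : ℕ → ℝ → ℝ := fun n => IccExtend hab ((Icc a b).domRestrict (f' n)) with hg
  have hgc : ∀ n, Continuous (g n) := fun n =>
    (continuousOn_iff_continuous_domRestrict.1 (hc n)).Icc_extend'
  have hgeq : ∀ n, ∀ y ∈ Icc a b, g n y = f' n y := fun n y hy => by
    simp [hg, IccExtend_of_mem hab _ hy, domRestrict_apply]
  have hgb : ∀ n y, ‖g n y‖ ≤ u n := fun n y => hb n _ (projIcc a b hab y).2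
  set F : ℕ → ℝ → ℝ := fun n y => f n a + ∫ s in a..y, g n s with hF
  have hFd : ∀ n y, HasDerivAt (F n) (g n y) y := fun n y =>
    ((hgc n).integral_hasStrictDerivAt a y).hasDerivAt.const_add _
  have hFf : ∀ n, ∀ y ∈ Icc a b, F n y = f n y := by
    intro n y hy
    have hsub : Icc a y ⊆ Icc a b := Icc_subset_Icc_right hy.2
    have h1 : ∫ s in a..y, g n s = ∫ s in a..y, f' n s := by
      refine intervalIntegral.integral_congr fun s hs => hgeq n s ?_
      rw [uIcc_of_le hy.1] at hs
      exact hsub hs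
    have := integral_eq_sub_of_hasDerivWithinAt_Icc hy.1
      (fun s hs => (hf n s (hsub hs)).mono hsub) ((hc n).mono hsub)
    simp only [hF]
    rw [h1, this]; ring
  have key := hasDerivAt_tsum hu hFd hgb (y₀ := a) (by simpa [hF] using hs) x
  have h2 : ∑' n, g n x = ∑' n, f' n x := tsum_congr fun n => hgeq n x hx
  rw [h2] at key
  exact key.hasDerivWithinAt.congr (fun y hy => tsum_congr fun n => (hFf n y hy).symm)
    (tsum_congr fun n => (hFf n x hx).symm)

/-! ### Neumann test functions: integration by parts, Sobolev inequality, second derivative test -/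

namespace IsNeumannTest

variable {φ φ₁ φ₂ ψ ψ₁ ψ₂ : ℝ → ℝ}

lemma continuousOn₀ (h : IsNeumannTest φ φ₁ φ₂) : ContinuousOn φ (Icc 0 1) :=
  fun x hx => (h.hasDeriv₁ x hx).continuousWithinAt

lemma continuousOn₁ (h : IsNeumannTest φ φ₁ φ₂) : ContinuousOn φ₁ (Icc 0 1) :=
  fun x hx => (h.hasDeriv₂ x hx).continuousWithinAt

protected lemma const (c : ℝ) : IsNeumannTest (fun _ => c) (fun _ => 0) (fun _ => 0) :=
  ⟨fun _ _ => hasDerivWithinAt_const _ _ _, fun _ _ => hasDerivWithinAt_const _ _ _,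
    continuousOn_const, rfl, rfl⟩

protected lemma add (h : IsNeumannTest φ φ₁ φ₂) (k : IsNeumannTest ψ ψ₁ ψ₂) :
    IsNeumannTest (fun x => φ x + ψ x) (fun x => φ₁ x + ψ₁ x) (fun x => φ₂ x + ψ₂ x) :=
  ⟨fun x hx => (h.hasDeriv₁ x hx).add (k.hasDeriv₁ x hx),
    fun x hx => (h.hasDeriv₂ x hx).add (k.hasDeriv₂ x hx), h.continuousOn.add k.continuousOn,
    by simp [h.left, k.left], by simp [h.right, k.right]⟩

protected lemma const_mul (c : ℝ) (h : IsNeumannTest φ φ₁ φ₂) :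
    IsNeumannTest (fun x => c * φ x) (fun x => c * φ₁ x) (fun x => c * φ₂ x) :=
  ⟨fun x hx => (h.hasDeriv₁ x hx).const_mul c, fun x hx => (h.hasDeriv₂ x hx).const_mul c,
    continuousOn_const.mul h.continuousOn, by simp [h.left], by simp [h.right]⟩

protected lemma sum {ι : Type*} (s : Finset ι) {f f₁ f₂ : ι → ℝ → ℝ}
    (h : ∀ i, IsNeumannTest (f i) (f₁ i) (f₂ i)) :
    IsNeumannTest (fun x => ∑ i ∈ s, f i x) (fun x => ∑ i ∈ s, f₁ i x)
      (fun x => ∑ i ∈ s, f₂ i x) :=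
  ⟨fun x hx => HasDerivWithinAt.fun_sum fun i _ => (h i).hasDeriv₁ x hx,
    fun x hx => HasDerivWithinAt.fun_sum fun i _ => (h i).hasDeriv₂ x hx,
    continuousOn_finsetSum _ fun i _ => (h i).continuousOn,
    by simp [(h _).left], by simp [(h _).right]⟩

/-- Symmetry of the second derivative with Neumann conditions. -/
lemma integral_mul_comm (h : IsNeumannTest φ φ₁ φ₂) (k : IsNeumannTest ψ ψ₁ ψ₂) :
    ∫ x in (0 : ℝ)..1, ψ x * φ₂ x = ∫ x in (0 : ℝ)..1, ψ₂ x * φ x := by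
  have hd : ∀ x ∈ Icc (0 : ℝ) 1, HasDerivWithinAt (fun x => ψ x * φ₁ x - ψ₁ x * φ x)
      (ψ x * φ₂ x - ψ₂ x * φ x) (Icc 0 1) x := fun x hx => by
    exact (((k.hasDeriv₁ x hx).fun_mul (h.hasDeriv₂ x hx)).fun_sub
      ((k.hasDeriv₂ x hx).fun_mul (h.hasDeriv₁ x hx))).congr_deriv (by ring)
  have hc1 := k.continuousOn₀.mul h.continuousOn
  have hc2 := k.continuousOn.mul h.continuousOn₀
  have := integral_eq_sub_of_hasDerivWithinAt_Icc zero_le_one hd (hc1.sub hc2)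
  rw [intervalIntegral.integral_sub
    ((uIcc_of_le (zero_le_one (α := ℝ)) ▸ hc1).intervalIntegrable)
    ((uIcc_of_le (zero_le_one (α := ℝ)) ▸ hc2).intervalIntegrable)] at this
  simp [h.left, h.right, k.left, k.right] at this
  linarith

/-- Integration by parts of `φ'' φ` with Neumann conditions. -/
lemma integral_mul_self (h : IsNeumannTest φ φ₁ φ₂) :
    ∫ x in (0 : ℝ)..1, φ₁ x ^ 2 = -∫ x in (0 : ℝ)..1, φ₂ x * φ x := by
  have hd : ∀ x ∈ Icc (0 : ℝ) 1, HasDerivWithinAt (fun x => φ₁ x * φ x)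
      (φ₂ x * φ x + φ₁ x ^ 2) (Icc 0 1) x := fun x hx => by
    exact ((h.hasDeriv₂ x hx).fun_mul (h.hasDeriv₁ x hx)).congr_deriv (by ring)
  have hc1 := h.continuousOn.mul h.continuousOn₀
  have hc2 := h.continuousOn₁.pow 2
  have := integral_eq_sub_of_hasDerivWithinAt_Icc zero_le_one hd (hc1.add hc2)
  rw [intervalIntegral.integral_add
    ((uIcc_of_le (zero_le_one (α := ℝ)) ▸ hc1).intervalIntegrable)
    ((uIcc_of_le (zero_le_one (α := ℝ)) ▸ hc2).intervalIntegrable)] at this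
  simp [h.left, h.right] at this
  linarith

/-- The inequality `f(x)² ≤ 2 ∫ f² + ∫ f'²` on the unit interval. -/
lemma sq_le (h : IsNeumannTest φ φ₁ φ₂) {x : ℝ} (hx : x ∈ Icc (0 : ℝ) 1) :
    φ x ^ 2 ≤ 2 * (∫ y in (0 : ℝ)..1, φ y ^ 2) + ∫ y in (0 : ℝ)..1, φ₁ y ^ 2 := by
  have hI : ∀ {g : ℝ → ℝ}, ContinuousOn g (Icc 0 1) → ∀ {a b : ℝ}, a ∈ Icc (0 : ℝ) 1 →
      b ∈ Icc (0 : ℝ) 1 → IntervalIntegrable g volume a b := fun hg a b ha hb =>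
    (hg.mono (uIcc_subset_Icc ha hb)).intervalIntegrable
  have h0 : (0 : ℝ) ∈ Icc (0 : ℝ) 1 := by simp
  have h1 : (1 : ℝ) ∈ Icc (0 : ℝ) 1 := by simp
  have c0 : ContinuousOn (fun y => φ y ^ 2) (Icc 0 1) := h.continuousOn₀.pow 2
  have c1 : ContinuousOn (fun y => φ₁ y ^ 2) (Icc 0 1) := h.continuousOn₁.pow 2
  have c2 : ContinuousOn (fun y => 2 * φ y * φ₁ y) (Icc 0 1) :=
    (continuousOn_const.mul h.continuousOn₀).mul h.continuousOn₁
  have hd : ∀ x ∈ Icc (0 : ℝ) 1, HasDerivWithinAt (fun x => φ x ^ 2)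
      (2 * φ x * φ₁ x) (Icc 0 1) x := fun x hx => by
    simpa using (h.hasDeriv₁ x hx).fun_pow 2
  -- `φ(x)² - φ(y)²` is the integral of `2φφ'`, and `|2φφ'| ≤ φ² + φ'²`. Averaging over `y` then
  -- gives the claim.
  have step : ∀ y ∈ Icc (0 : ℝ) 1, φ x ^ 2 - φ y ^ 2 ≤ ∫ s in (0 : ℝ)..1, (φ s ^ 2 + φ₁ s ^ 2) := by
    intro y hy
    have e : φ x ^ 2 - φ y ^ 2 = ∫ s in y..x, 2 * φ s * φ₁ s := by
      rw [intervalIntegral.integral_interval_sub_left (hI c2 h0 hx) (hI c2 h0 hy) |>.symm,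
        integral_eq_sub_of_hasDerivWithinAt_Icc hx.1
          (fun s hs => (hd s ⟨hs.1, hs.2.trans hx.2⟩).mono (Icc_subset_Icc_right hx.2))
          (c2.mono (Icc_subset_Icc_right hx.2)),
        integral_eq_sub_of_hasDerivWithinAt_Icc hy.1
          (fun s hs => (hd s ⟨hs.1, hs.2.trans hy.2⟩).mono (Icc_subset_Icc_right hy.2))
          (c2.mono (Icc_subset_Icc_right hy.2))]
      ring
    rw [e]
    have hcs : ContinuousOn (fun s => φ s ^ 2 + φ₁ s ^ 2) (Icc 0 1) := c0.add c1
    calc ∫ s in y..x, 2 * φ s * φ₁ s ≤ |∫ s in y..x, 2 * φ s * φ₁ s| := le_abs_self _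
      _ ≤ |∫ s in y..x, (φ s ^ 2 + φ₁ s ^ 2)| := by
        refine intervalIntegral.norm_integral_le_abs_of_norm_le (f := fun s => 2 * φ s * φ₁ s)
          (ae_of_all _ fun s => ?_) (hI hcs hy hx)
        rw [Real.norm_eq_abs, abs_le]
        constructor <;> nlinarith [sq_nonneg (φ s + φ₁ s), sq_nonneg (φ s - φ₁ s)]
      _ ≤ |∫ s in (0 : ℝ)..1, (φ s ^ 2 + φ₁ s ^ 2)| := by
        refine intervalIntegral.abs_integral_mono_interval ?_ (ae_of_all _ fun s => by positivity)
          (hI hcs h0 h1)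
        rw [uIoc_of_le zero_le_one]
        intro s hs
        rcases le_total y x with hyx | hyx
        · rw [uIoc_of_le hyx] at hs
          exact ⟨hy.1.trans_lt hs.1, hs.2.trans hx.2⟩
        · rw [uIoc_of_ge hyx] at hs
          exact ⟨hx.1.trans_lt hs.1, hs.2.trans hy.2⟩
      _ = ∫ s in (0 : ℝ)..1, (φ s ^ 2 + φ₁ s ^ 2) :=
        abs_of_nonneg (intervalIntegral.integral_nonneg zero_le_one fun s _ => by positivity)
  have hm := intervalIntegral.integral_mono_on zero_le_one (μ := volume)
    (f := fun y => φ x ^ 2 - φ y ^ 2) (g := fun _ => ∫ s in (0 : ℝ)..1, (φ s ^ 2 + φ₁ s ^ 2))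
    (hI (continuousOn_const.sub c0) h0 h1) (hI continuousOn_const h0 h1) step
  rw [intervalIntegral.integral_sub (hI continuousOn_const h0 h1) (hI c0 h0 h1),
    intervalIntegral.integral_const, intervalIntegral.integral_const,
    intervalIntegral.integral_add (hI c0 h0 h1) (hI c1 h0 h1)] at hm
  simp only [sub_zero, one_smul] at hm
  linarith

/-- Second derivative test at a minimum on `[0,1]`, including the end points. -/
lemma second_deriv_nonneg (h : IsNeumannTest φ φ₁ φ₂) {x : ℝ} (hx : x ∈ Icc (0 : ℝ) 1)
    (hmin : ∀ y ∈ Icc (0 : ℝ) 1, φ x ≤ φ y) : 0 ≤ φ₂ x := by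
  by_contra! hneg
  -- At an end point the first derivative vanishes by the Neumann condition, not by minimality.
  have hzero : φ₁ x = 0 := by
    rcases hx.1.eq_or_lt with h0 | h0
    · rw [← h0, h.left]
    rcases hx.2.eq_or_lt with h1 | h1
    · rw [h1, h.right]
    have hn := Icc_mem_nhds h0 h1
    exact IsLocalMin.hasDerivAt_eq_zero (f := φ) (by filter_upwards [hn] with y hy using hmin y hy)
      ((h.hasDeriv₁ x hx).hasDerivAt hn)
  have hnear : ∀ᶠ y in 𝓝[Icc 0 1] x, φ₂ y < 0 :=
    (h.continuousOn x hx).eventually (gt_mem_nhds hneg)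
  obtain ⟨r, hr, hball⟩ := Metric.mem_nhdsWithin_iff.1 hnear
  have hball' : ∀ y ∈ Icc (0 : ℝ) 1, |y - x| < r → φ₂ y < 0 := fun y hy hyr =>
    hball ⟨by simpa [Real.dist_eq] using hyr, hy⟩
  -- a mean value argument on an interval contained in the neighbourhood
  have mvt : ∀ {f f' : ℝ → ℝ} {a b : ℝ}, a < b → a ∈ Icc (0 : ℝ) 1 → b ∈ Icc (0 : ℝ) 1 →
      (∀ y ∈ Icc (0 : ℝ) 1, HasDerivWithinAt f (f' y) (Icc 0 1) y) →
      ∃ c ∈ Ioo a b, f b - f a = f' c * (b - a) := by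
    intro f f' a b hab ha hb hf
    obtain ⟨c, hc, e⟩ := exists_hasDerivAt_eq_slope f f' hab
      (fun y hy => ((hf y ⟨ha.1.trans hy.1, hy.2.trans hb.2⟩).continuousWithinAt).mono
        (Icc_subset_Icc ha.1 hb.2))
      (fun y hy => (hf y ⟨ha.1.trans hy.1.le, hy.2.le.trans hb.2⟩).hasDerivAt
        (Icc_mem_nhds (ha.1.trans_lt hy.1) (hy.2.trans_le hb.2)))
    refine ⟨c, hc, ?_⟩
    rw [e, div_mul_cancel₀ _ (sub_pos.2 hab).ne']
  -- Move away from `x` by at most `r / 2`, to the left if `x = 1` and to the right otherwise. Two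
  -- mean value steps, for `φ` and then for `φ₁`, produce a value of `φ` below the minimum.
  rcases hx.2.eq_or_lt with h1 | h1
  · set a := max 0 (x - r / 2) with ha
    have hax : a < x := max_lt (by linarith) (by linarith)
    have haI : a ∈ Icc (0 : ℝ) 1 := ⟨le_max_left _ _, hax.le.trans hx.2⟩
    obtain ⟨c, hc, e⟩ := mvt hax haI hx h.hasDeriv₁
    have hcI : c ∈ Icc (0 : ℝ) 1 := ⟨haI.1.trans hc.1.le, hc.2.le.trans hx.2⟩
    obtain ⟨d, hd, e'⟩ := mvt hc.2 hcI hx h.hasDeriv₂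
    have hdI : d ∈ Icc (0 : ℝ) 1 := ⟨hcI.1.trans hd.1.le, hd.2.le.trans hx.2⟩
    have := hball' d hdI (by
      rw [abs_lt]
      constructor <;> linarith [le_max_right 0 (x - r / 2), hd.1, hd.2, hc.1])
    have := hmin a haI
    nlinarith [mul_pos (neg_pos.2 ‹φ₂ d < 0›) (sub_pos.2 hc.2), sub_pos.2 hax]
  · set b := min 1 (x + r / 2) with hb
    have hxb : x < b := lt_min h1 (by linarith)
    have hbI : b ∈ Icc (0 : ℝ) 1 := ⟨hx.1.trans hxb.le, min_le_left _ _⟩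
    obtain ⟨c, hc, e⟩ := mvt hxb hx hbI h.hasDeriv₁
    have hcI : c ∈ Icc (0 : ℝ) 1 := ⟨hx.1.trans hc.1.le, hc.2.le.trans hbI.2⟩
    obtain ⟨d, hd, e'⟩ := mvt hc.1 hx hcI h.hasDeriv₂
    have hdI : d ∈ Icc (0 : ℝ) 1 := ⟨hx.1.trans hd.1.le, hd.2.le.trans hcI.2⟩
    have := hball' d hdI (by
      rw [abs_lt]
      constructor <;> linarith [min_le_right 1 (x + r / 2), hd.1, hd.2, hc.2])
    have := hmin b hbI
    nlinarith [mul_pos (neg_pos.2 ‹φ₂ d < 0›) (sub_pos.2 hc.1), sub_pos.2 hxb]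

end IsNeumannTest

/-! ### Maximum principle and uniqueness for the Cauchy problem -/

/-- Weak maximum principle for `∂ₜy ≥ ∂ₓₓy - V y` with Neumann conditions and `V > 0`. -/
lemma parabolic_maximum_principle {V : C(I, ℝ)} (hV : ∀ x, 0 < V x) {T : ℝ} (hT : 0 ≤ T)
    {y yt y₁ y₂ : ℝ → ℝ → ℝ}
    (hc : ContinuousOn (fun p : ℝ × ℝ => y p.1 p.2) (Icc 0 T ×ˢ Icc 0 1))
    (h0 : ∀ x ∈ Icc (0 : ℝ) 1, 0 ≤ y 0 x)
    (ht : ∀ t ∈ Ioc 0 T, ∀ x ∈ Icc (0 : ℝ) 1,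
      HasDerivWithinAt (fun s => y s x) (yt t x) (Icc 0 T) t)
    (hx : ∀ t ∈ Ioc 0 T, IsNeumannTest (y t) (y₁ t) (y₂ t))
    (hineq : ∀ t ∈ Ioc 0 T, ∀ x : I, y₂ t x - V x * y t x ≤ yt t x) :
    ∀ t ∈ Icc 0 T, ∀ x ∈ Icc (0 : ℝ) 1, 0 ≤ y t x := by
  obtain ⟨⟨t₀, x₀⟩, ⟨ht₀, hx₀⟩, hmin⟩ := (isCompact_Icc.prod isCompact_Icc).exists_isMinOn
    (⟨(0, 0), ⟨by simp [hT], by simp⟩⟩ : (Icc (0 : ℝ) T ×ˢ Icc (0 : ℝ) 1).Nonempty) hc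
  simp only at ht₀ hx₀
  have hmin' : ∀ t ∈ Icc 0 T, ∀ x ∈ Icc (0 : ℝ) 1, y t₀ x₀ ≤ y t x := fun t ht x hx =>
    hmin (show (t, x) ∈ Icc 0 T ×ˢ Icc (0 : ℝ) 1 from ⟨ht, hx⟩)
  intro t htt x hxx
  refine le_trans ?_ (hmin' t htt x hxx)
  by_contra! hneg
  have htpos : 0 < t₀ := by
    refine ht₀.1.lt_of_ne fun h => ?_
    rw [← h] at hneg
    exact absurd (h0 x₀ hx₀) (not_le.2 hneg)
  have htI : t₀ ∈ Ioc 0 T := ⟨htpos, ht₀.2⟩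
  have h2 : 0 ≤ y₂ t₀ x₀ := (hx t₀ htI).second_deriv_nonneg hx₀ fun z hz => hmin' t₀ ht₀ z hz
  -- At a negative minimum both `y₂` and `-V y` push the time derivative up, strictly because `V >
  -- 0`. The backward difference quotients at a minimum are nonpositive, a contradiction.
  have h3 := hineq t₀ htI ⟨x₀, hx₀⟩
  have h4 : 0 < yt t₀ x₀ := by
    have := mul_pos (hV ⟨x₀, hx₀⟩) (neg_pos.2 hneg)
    simp only at h3
    linarith
  have h5 : HasDerivWithinAt (fun s => y s x₀) (yt t₀ x₀) (Iio t₀) t₀ := by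
    refine (ht t₀ htI x₀ hx₀).mono_of_mem_nhdsWithin ?_
    filter_upwards [Ioo_mem_nhdsLT htpos] with s hs using ⟨hs.1.le, hs.2.le.trans ht₀.2⟩
  have h6 := (hasDerivWithinAt_iff_tendsto_slope' (by simp)).1 h5
  have h7 : ∀ᶠ s in 𝓝[<] t₀, 0 < slope (fun s => y s x₀) t₀ s := h6.eventually (lt_mem_nhds h4)
  obtain ⟨s, hs, hs'⟩ := (h7.and (Ioo_mem_nhdsLT htpos)).exists
  rw [slope_def_field] at hs
  have h8 := hmin' s ⟨hs'.1.le, hs'.2.le.trans ht₀.2⟩ x₀ hx₀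
  have : (y s x₀ - y t₀ x₀) / (s - t₀) ≤ 0 :=
    div_nonpos_of_nonneg_of_nonpos (by linarith) (by linarith [hs'.2])
  linarith

/-- A solution of `f'' = q f` with zero Cauchy data at `0` vanishes. -/
lemma eq_zero_of_cauchy_data_zero {f f₁ q : ℝ → ℝ} (hq : ContinuousOn q (Icc 0 1))
    (h₁ : ∀ x ∈ Icc (0 : ℝ) 1, HasDerivWithinAt f (f₁ x) (Icc 0 1) x)
    (h₂ : ∀ x ∈ Icc (0 : ℝ) 1, HasDerivWithinAt f₁ (q x * f x) (Icc 0 1) x)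
    (h0 : f 0 = 0) (h0' : f₁ 0 = 0) : ∀ x ∈ Icc (0 : ℝ) 1, f x = 0 := by
  obtain ⟨Q, hQ⟩ := isCompact_Icc.exists_bound_of_continuousOn hq
  have hd : ∀ x ∈ Icc (0 : ℝ) 1, HasDerivWithinAt (fun x => f x ^ 2 + f₁ x ^ 2)
      (2 * f x * f₁ x + 2 * f₁ x * (q x * f x)) (Icc 0 1) x := fun x hx => by
    simpa using ((h₁ x hx).fun_pow 2).fun_add ((h₂ x hx).fun_pow 2)
  -- Gronwall for the energy `f² + f₁²`, whose derivative `2 f f₁ (1 + q)` is at most `1 + Q` times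
  -- the energy.
  have key := norm_le_gronwallBound_of_norm_deriv_right_le (f := fun x => f x ^ 2 + f₁ x ^ 2)
    (f' := fun x => 2 * f x * f₁ x + 2 * f₁ x * (q x * f x)) (δ := 0) (K := 1 + Q) (ε := 0)
    (a := 0) (b := 1) (fun x hx => (hd x hx).continuousWithinAt)
    (fun x hx => (hd x ⟨hx.1, hx.2.le⟩).mono_of_mem_nhdsWithin (Icc_mem_nhdsGE_of_mem hx))
    (by simp [h0, h0']) (fun x hx => by
      have hqx := hQ x ⟨hx.1, hx.2.le⟩
      have h2 : |2 * f x * f₁ x| ≤ f x ^ 2 + f₁ x ^ 2 := by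
        rw [abs_le]
        constructor <;> nlinarith [sq_nonneg (f x + f₁ x), sq_nonneg (f x - f₁ x)]
      have h3 : 2 * f x * f₁ x + 2 * f₁ x * (q x * f x) = (2 * f x * f₁ x) * (1 + q x) := by ring
      rw [h3, norm_mul, Real.norm_eq_abs, Real.norm_eq_abs (f x ^ 2 + f₁ x ^ 2),
        abs_of_nonneg (by positivity : 0 ≤ f x ^ 2 + f₁ x ^ 2), add_zero, mul_comm]
      have h4 : ‖1 + q x‖ ≤ 1 + Q := (norm_add_le _ _).trans (by simpa using hqx)
      exact mul_le_mul h4 h2 (abs_nonneg _) ((norm_nonneg _).trans h4))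
  intro x hx
  have := key x hx
  simp only [gronwallBound_ε0, zero_mul] at this
  have h5 : f x ^ 2 + f₁ x ^ 2 = 0 := norm_le_zero_iff.1 this
  nlinarith [sq_nonneg (f x), sq_nonneg (f₁ x)]

/-! ### Continuous functions in `L²` and the coercivity estimate -/

/-- The class in `L²` of a continuous function. -/
abbrev classL2 : C(I, ℝ) →L[ℝ] L2I := ContinuousMap.toLp 2 (volume : Measure I) ℝ

lemma classL2_ae (g : C(I, ℝ)) : ∀ᵐ x : I, classL2 g x = g x :=
  ContinuousMap.coeFn_toLp _ _

lemma inner_classL2 (g : C(I, ℝ)) (f : L2I) : inner ℝ (classL2 g) f = ∫ x : I, g x * f x := by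
  rw [L2.inner_def]
  refine integral_congr_ae ?_
  filter_upwards [classL2_ae g] with x hx
  rw [hx]
  simp [mul_comm]

lemma integral_mul_classL2 (F : I → ℝ) (g : C(I, ℝ)) :
    ∫ x : I, F x * classL2 g x = ∫ x : I, F x * g x := by
  refine integral_congr_ae ?_
  filter_upwards [classL2_ae g] with x hx
  rw [hx]

/-- A nonempty relatively open set, even one around an end point, meets the open interval. This
makes integrals of nonzero nonnegative continuous functions positive and `classL2` injective. -/
instance : (volume : Measure I).IsOpenPosMeasure := by
  refine ⟨fun U hU hne => ?_⟩
  obtain ⟨W, hW, rfl⟩ := isOpen_induced_iff.1 hU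
  obtain ⟨⟨x, hx⟩, hxW⟩ := hne
  have hcl : x ∈ closure (Ioo (0 : ℝ) 1) := by rwa [closure_Ioo zero_ne_one]
  have hpos : 0 < volume (W ∩ Ioo (0 : ℝ) 1) :=
    (hW.inter isOpen_Ioo).measure_pos volume (mem_closure_iff.1 hcl W hW hxW)
  refine (hpos.trans_le ?_).ne'
  rw [Measure.Subtype.volume_def, Measure.comap_apply _ Subtype.val_injective
    (fun s hs => measurableSet_Icc.subtype_image hs) _ hU.measurableSet, Subtype.image_preimage_coe]
  exact measure_mono fun y hy => ⟨Ioo_subset_Icc_self hy.2, hy.1⟩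

lemma ContinuousMap.integrable_unitInterval (g : C(I, ℝ)) : Integrable (fun x : I => g x) :=
  g.continuous.integrable_of_hasCompactSupport (HasCompactSupport.of_compactSpace _)

lemma ContinuousMap.integral_pos_unitInterval {g : C(I, ℝ)} (hg : ∀ x, 0 ≤ g x) {x₀ : I}
    (hx₀ : g x₀ ≠ 0) : 0 < ∫ x : I, g x :=
  g.continuous.integral_pos_of_hasCompactSupport_nonneg_nonzero
    (HasCompactSupport.of_compactSpace _) hg hx₀

namespace IsNeumannTest

variable {φ φ₁ φ₂ : ℝ → ℝ} {V : C(I, ℝ)}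

/-- A test function as a continuous function on `[0,1]`. -/
def toC (h : IsNeumannTest φ φ₁ φ₂) : C(I, ℝ) :=
  ⟨fun x => φ x, h.continuousOn₀.domRestrict⟩

/-- The derivative of a test function as a continuous function on `[0,1]`. -/
def derivC (h : IsNeumannTest φ φ₁ φ₂) : C(I, ℝ) :=
  ⟨fun x => φ₁ x, h.continuousOn₁.domRestrict⟩

/-- The second derivative of a test function as a continuous function on `[0,1]`. -/
def secondC (h : IsNeumannTest φ φ₁ φ₂) : C(I, ℝ) :=
  ⟨fun x => φ₂ x, h.continuousOn.domRestrict⟩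

/-- The function `φ'' - V φ`. -/
def opC (h : IsNeumannTest φ φ₁ φ₂) (V : C(I, ℝ)) : C(I, ℝ) :=
  ⟨fun x => φ₂ x - V x * φ x,
    h.continuousOn.domRestrict.sub (V.continuous.mul h.continuousOn₀.domRestrict)⟩

@[simp] lemma toC_apply (h : IsNeumannTest φ φ₁ φ₂) (x : I) : h.toC x = φ x := rfl

@[simp] lemma derivC_apply (h : IsNeumannTest φ φ₁ φ₂) (x : I) : h.derivC x = φ₁ x := rfl

@[simp] lemma secondC_apply (h : IsNeumannTest φ φ₁ φ₂) (x : I) : h.secondC x = φ₂ x := rfl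

@[simp] lemma opC_apply (h : IsNeumannTest φ φ₁ φ₂) (x : I) : h.opC V x = φ₂ x - V x * φ x := rfl

/-- By parts, `⟨-Aφ, φ⟩ = ∫ φ'² + ∫ Vφ²`. Since `V` is bounded below by a positive constant, this
dominates the `H¹` norm, and `sq_le` bounds the values of `φ` by that norm. -/
lemma exists_sq_le (hV : ∀ x, 0 < V x) : ∃ C : ℝ, 0 < C ∧
    ∀ (φ φ₁ φ₂ : ℝ → ℝ) (h : IsNeumannTest φ φ₁ φ₂) (x : I),
      φ x ^ 2 ≤ C * -∫ y : I, h.opC V y * φ y := by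
  obtain ⟨x₀, -, hx₀⟩ := isCompact_univ.exists_isMinOn univ_nonempty V.continuous.continuousOn
  set m := V x₀ with hm
  have hmpos : 0 < m := hV x₀
  have hmin : ∀ x, m ≤ V x := fun x => hx₀ (mem_univ x)
  -- `2 / m` absorbs `2 ∫ φ²` through `m ∫ φ² ≤ ∫ Vφ²`; the summand `1` absorbs `∫ φ'²`.
  refine ⟨2 / m + 1, by positivity, fun φ φ₁ φ₂ h x => ?_⟩
  have h1 := h.sq_le x.2
  have e1 := h.integral_mul_self
  rw [← integral_unitInterval_coe] at h1
  rw [← integral_unitInterval_coe, ← integral_unitInterval_coe] at e1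
  rw [← integral_unitInterval_coe] at h1
  have i1 := (h.toC * h.toC).integrable_unitInterval
  have i2 := (V * (h.toC * h.toC)).integrable_unitInterval
  have i3 := (h.secondC * h.toC).integrable_unitInterval
  simp only [ContinuousMap.mul_apply, toC_apply, secondC_apply] at i1 i2 i3
  have e2 : ∫ y : I, h.opC V y * φ y = (∫ y : I, φ₂ y * φ y) - ∫ y : I, V y * (φ y * φ y) := by
    rw [← integral_sub i3 i2]
    exact integral_congr_ae (ae_of_all _ fun y => by simp; ring)
  have h2 : m * ∫ y : I, φ y ^ 2 ≤ ∫ y : I, V y * (φ y * φ y) := by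
    rw [← integral_const_mul]
    refine integral_mono ((i1.const_mul m).congr (ae_of_all _ fun y => by simp only; ring)) i2 fun y => ?_
    simp only
    nlinarith [hmin y, sq_nonneg (φ y)]
  have h3 : 0 ≤ ∫ y : I, φ₁ y ^ 2 := integral_nonneg fun y => sq_nonneg _
  have h4 : 0 ≤ ∫ y : I, φ y ^ 2 := integral_nonneg fun y => sq_nonneg _
  set A := ∫ y : I, φ y ^ 2
  set B := ∫ y : I, φ₁ y ^ 2
  set D := ∫ y : I, V y * (φ y * φ y)
  have e3 : -∫ y : I, h.opC V y * φ y = B + D := by rw [e2]; linarith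
  rw [e3]
  have h5 : A ≤ D / m := by rw [le_div_iff₀ hmpos]; linarith
  have hD : 0 ≤ D := le_trans (by positivity) h2
  have : (2 / m + 1) * (B + D) = 2 * (D / m) + B + (2 / m * B + D) := by ring
  rw [this]
  have : 0 ≤ 2 / m * B := by positivity
  linarith

end IsNeumannTest

/-! ### Spectral estimates for the eigenbasis -/

namespace IsNeumannEigenbasis

variable {V : C(I, ℝ)} {κ : ℕ → ℝ} {e : ℕ → ℝ → ℝ}

/-- The derivative of an eigenfunction. -/
def deriv (he : IsNeumannEigenbasis V κ e) (n : ℕ) : ℝ → ℝ := (he.eigen n).choose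

/-- The potential extended to the line. -/
def _root_.extendPotential (V : C(I, ℝ)) : ℝ → ℝ := IccExtend zero_le_one V

@[simp] lemma _root_.extendPotential_coe (V : C(I, ℝ)) (x : I) : extendPotential V x = V x :=
  IccExtend_val _ _ x

lemma _root_.continuous_extendPotential (V : C(I, ℝ)) : Continuous (extendPotential V) :=
  V.continuous.Icc_extend'

/-- Makes eigenfunctions admissible both in the weak formulation and in the estimates for test
functions. -/
lemma test (he : IsNeumannEigenbasis V κ e) (n : ℕ) :
    IsNeumannTest (e n) (he.deriv n) (fun x => (extendPotential V x - κ n) * e n x) := by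
  obtain ⟨h1, h2, h3, h4⟩ := (he.eigen n).choose_spec
  have h1' : ∀ x ∈ Icc (0 : ℝ) 1, HasDerivWithinAt (e n) (he.deriv n x) (Icc 0 1) x :=
    fun x hx => h1 ⟨x, hx⟩
  refine ⟨h1', fun x hx => ?_, ?_, h3, h4⟩
  · refine (h2 ⟨x, hx⟩).congr_deriv ?_
    rw [sub_mul, ← extendPotential_coe V ⟨x, hx⟩]
  · exact ((continuous_extendPotential V).continuousOn.sub continuousOn_const).mul
      fun x hx => (h1' x hx).continuousWithinAt

/-- The eigenfunctions as continuous functions on `[0,1]`. -/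
def eC (he : IsNeumannEigenbasis V κ e) (n : ℕ) : C(I, ℝ) := (he.test n).toC

/-- The derivatives of the eigenfunctions as continuous functions on `[0,1]`. -/
def dC (he : IsNeumannEigenbasis V κ e) (n : ℕ) : C(I, ℝ) := (he.test n).derivC

@[simp] lemma eC_apply (he : IsNeumannEigenbasis V κ e) (n : ℕ) (x : I) : he.eC n x = e n x := rfl

@[simp] lemma dC_apply (he : IsNeumannEigenbasis V κ e) (n : ℕ) (x : I) :
    he.dC n x = he.deriv n x := rfl

lemma orthonormal_classL2 (he : IsNeumannEigenbasis V κ e) :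
    Orthonormal ℝ fun n => classL2 (he.eC n) := by
  classical
  rw [orthonormal_iff_ite]
  intro m n
  rw [inner_classL2, integral_mul_classL2]
  exact he.orthonormal m n

/-- The eigenfunctions as a Hilbert basis of `L²`. -/
def basis (he : IsNeumannEigenbasis V κ e) : HilbertBasis ℕ ℝ L2I :=
  HilbertBasis.mkOfOrthogonalEqBot he.orthonormal_classL2 <| by
    rw [Submodule.eq_bot_iff]
    intro f hf
    refine he.complete f fun n => ?_
    have := Submodule.inner_right_of_mem_orthogonal
      (Submodule.subset_span (mem_range_self (f := fun n => classL2 (he.eC n)) n)) hf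
    rwa [inner_classL2] at this

lemma basis_apply (he : IsNeumannEigenbasis V κ e) (n : ℕ) : he.basis n = classL2 (he.eC n) := by
  simp [basis]

/-- The coefficient functionals on `L²`. -/
def coord (he : IsNeumannEigenbasis V κ e) (n : ℕ) : L2I →L[ℝ] ℝ := innerSL ℝ (he.basis n)

lemma coord_apply (he : IsNeumannEigenbasis V κ e) (n : ℕ) (f : L2I) :
    he.coord n f = ∫ x : I, e n x * f x := by
  rw [coord, innerSL_apply_apply, basis_apply, inner_classL2]
  rfl

lemma coord_classL2 (he : IsNeumannEigenbasis V κ e) (n : ℕ) (g : C(I, ℝ)) :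
    he.coord n (classL2 g) = ∫ x : I, e n x * g x := by
  rw [coord_apply, integral_mul_classL2]

lemma coord_toL2 (he : IsNeumannEigenbasis V κ e) (n : ℕ) (v : P1) :
    he.coord n v.toL2 = coeff e n v := he.coord_classL2 n v.toC

lemma norm_coord_le (he : IsNeumannEigenbasis V κ e) (n : ℕ) : ‖he.coord n‖ ≤ 1 := by
  rw [coord, innerSL_apply_norm, he.basis.orthonormal.1 n]

lemma abs_coord_le (he : IsNeumannEigenbasis V κ e) (n : ℕ) (f : L2I) : |he.coord n f| ≤ ‖f‖ := by
  simpa using (he.coord n).le_of_opNorm_le (he.norm_coord_le n) f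

lemma ext_coord (he : IsNeumannEigenbasis V κ e) {f g : L2I}
    (h : ∀ n, he.coord n f = he.coord n g) : f = g := by
  rw [← sub_eq_zero]
  refine he.complete _ fun n => ?_
  rw [← he.coord_apply, map_sub, h, sub_self]

/-- Parseval's identity. -/
lemma hasSum_coord_mul (he : IsNeumannEigenbasis V κ e) (f g : L2I) :
    HasSum (fun n => he.coord n f * he.coord n g) (inner ℝ f g) := by
  have := he.basis.hasSum_inner_mul_inner f g
  simpa [coord, real_inner_comm] using this

lemma summable_coord_sq (he : IsNeumannEigenbasis V κ e) (f : L2I) :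
    Summable fun n => he.coord n f ^ 2 := by
  simpa [sq] using (he.hasSum_coord_mul f f).summable

lemma coord_basis (he : IsNeumannEigenbasis V κ e) (m n : ℕ) :
    he.coord m (classL2 (he.eC n)) = if m = n then 1 else 0 := by
  rw [coord_classL2]
  exact he.orthonormal m n

/-- The coefficients of `φ'' - V φ` for a Neumann test function. -/
lemma coord_opC (he : IsNeumannEigenbasis V κ e) {φ φ₁ φ₂ : ℝ → ℝ} (h : IsNeumannTest φ φ₁ φ₂)
    (n : ℕ) : he.coord n (classL2 (h.opC V)) = -κ n * he.coord n (classL2 h.toC) := by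
  rw [coord_classL2, coord_classL2]
  have key := h.integral_mul_comm (he.test n)
  rw [← integral_unitInterval_coe, ← integral_unitInterval_coe] at key
  have i1 := (he.eC n * h.secondC).integrable_unitInterval
  have i2 := (V * (he.eC n * h.toC)).integrable_unitInterval
  have i3 := (he.eC n * h.toC).integrable_unitInterval
  simp only [ContinuousMap.mul_apply, IsNeumannTest.toC_apply, IsNeumannTest.secondC_apply,
    eC_apply] at i1 i2 i3
  have e1 : ∫ x : I, e n x * h.opC V x = (∫ x : I, e n x * φ₂ x) - ∫ x : I, V x * (e n x * φ x) := by
    rw [← integral_sub i1 i2]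
    exact integral_congr_ae (ae_of_all _ fun y => by simp; ring)
  have e2 : ∫ x : I, (extendPotential V x - κ n) * e n x * φ x
      = (∫ x : I, V x * (e n x * φ x)) - κ n * ∫ x : I, e n x * φ x := by
    rw [← integral_const_mul, ← integral_sub i2 (i3.const_mul _)]
    exact integral_congr_ae (ae_of_all _ fun y => by simp; ring)
  rw [e1, key, e2]
  simp

variable (hV : ∀ x, 0 < V x)

/-- The quadratic form `⟨-Aφ, φ⟩` is diagonal in the eigenbasis, by Parseval and `coord_opC`. -/
lemma sum_sq_le (he : IsNeumannEigenbasis V κ e) {C : ℝ}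
    (hC : ∀ (φ φ₁ φ₂ : ℝ → ℝ) (h : IsNeumannTest φ φ₁ φ₂) (x : I),
      φ x ^ 2 ≤ C * -∫ y : I, h.opC V y * φ y) (a : ℕ → ℝ) (s : Finset ℕ) (x : I) :
    (∑ n ∈ s, a n * e n x) ^ 2 ≤ C * ∑ n ∈ s, κ n * a n ^ 2 := by
  classical
  have ht := IsNeumannTest.sum s fun n => (he.test n).const_mul (a n)
  refine (hC _ _ _ ht x).trans_eq ?_
  congr 1
  have hT : ht.toC = ∑ n ∈ s, a n • he.eC n := by
    ext y
    simp [ContinuousMap.sum_apply]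
  have hcoord : ∀ k, he.coord k (classL2 ht.toC) = if k ∈ s then a k else 0 := fun k => by
    simp only [hT, map_sum, map_smul, coord_basis, smul_eq_mul]
    simp
  have e1 : ∫ y : I, ht.opC V y * ∑ n ∈ s, a n * e n y
      = inner ℝ (classL2 (ht.opC V)) (classL2 ht.toC) := by
    rw [inner_classL2, integral_mul_classL2]
    rfl
  rw [e1, ← (he.hasSum_coord_mul _ _).tsum_eq, tsum_eq_sum (s := s), ← Finset.sum_neg_distrib]
  · refine Finset.sum_congr rfl fun n hn => ?_
    rw [coord_opC, hcoord, if_pos hn]; ring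
  · intro n hn
    rw [hcoord, if_neg hn, mul_zero]

include hV in
lemma eigenvalue_pos (he : IsNeumannEigenbasis V κ e) (n : ℕ) : 0 < κ n := by
  obtain ⟨C, hC0, hC⟩ := IsNeumannTest.exists_sq_le hV
  have h1 : ∀ x : I, e n x * e n x ≤ C * κ n := fun x => by
    simpa [sq] using he.sum_sq_le hC (fun _ => 1) {n} x
  have h2 := integral_mono (he.eC n * he.eC n).integrable_unitInterval
    (integrable_const (C * κ n)) h1
  have h3 := he.orthonormal n n
  simp only [ContinuousMap.mul_apply, eC_apply, h3, if_true, integral_const] at h2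
  simp at h2
  by_contra! h4
  nlinarith

include hV in
/-- Bounds for the eigenfunctions, and summability of the inverse eigenvalues. -/
lemma exists_bound (he : IsNeumannEigenbasis V κ e) :
    (Summable fun n => (κ n)⁻¹) ∧ ∃ C : ℝ, 0 < C ∧ (∀ n, 1 ≤ C * κ n) ∧
      ∀ n (x : I), e n x ^ 2 ≤ C * κ n := by
  obtain ⟨C, hC0, hC⟩ := IsNeumannTest.exists_sq_le hV
  have hpos := he.eigenvalue_pos hV
  have h1 : ∀ n (x : I), e n x ^ 2 ≤ C * κ n := fun n x => by
    simpa [sq] using he.sum_sq_le hC (fun _ => 1) {n} x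
  have hint : ∀ n, ∫ x : I, e n x ^ 2 = 1 := fun n => by
    simpa [sq] using he.orthonormal n n
  have hi : ∀ n, Integrable fun x : I => e n x ^ 2 := fun n =>
    (he.eC n ^ 2).integrable_unitInterval
  have h2 : ∀ n, 1 ≤ C * κ n := fun n => by
    have := integral_mono (hi n) (integrable_const (C * κ n)) (h1 n)
    rw [hint] at this
    simpa using this
  refine ⟨?_, C, hC0, h2, h1⟩
  have h3 : ∀ (s : Finset ℕ) (x : I), ∑ n ∈ s, e n x ^ 2 * (κ n)⁻¹ ≤ C := by
    intro s x
    -- With this choice both sides contain the same sum `S`, so `S² ≤ C S` and `S ≤ C`. Integrating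
    -- over `x` leaves the partial sums of `1/κ n`.
    have h4 := he.sum_sq_le hC (fun n => e n x * (κ n)⁻¹) s x
    have e1 : ∑ n ∈ s, e n x * (κ n)⁻¹ * e n x = ∑ n ∈ s, e n x ^ 2 * (κ n)⁻¹ :=
      Finset.sum_congr rfl fun n _ => by ring
    have e2 : ∑ n ∈ s, κ n * (e n x * (κ n)⁻¹) ^ 2 = ∑ n ∈ s, e n x ^ 2 * (κ n)⁻¹ :=
      Finset.sum_congr rfl fun n _ => by
        have := (hpos n).ne'
        field_simp
    rw [e1, e2] at h4
    have h5 : 0 ≤ ∑ n ∈ s, e n x ^ 2 * (κ n)⁻¹ :=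
      Finset.sum_nonneg fun n _ => mul_nonneg (sq_nonneg _) (inv_nonneg.2 (hpos n).le)
    by_contra! h6
    nlinarith
  refine summable_of_sum_le (c := C) (fun n => inv_nonneg.2 (hpos n).le) fun s => ?_
  have h7 := integral_mono (integrable_finsetSum s fun n _ => (hi n).mul_const (κ n)⁻¹)
    (integrable_const C) (h3 s)
  rw [integral_finsetSum s fun n _ => (hi n).mul_const (κ n)⁻¹] at h7
  simpa [integral_mul_const, hint] using h7

/-- The second derivatives of the eigenfunctions as continuous functions on `[0,1]`. -/
def sC (he : IsNeumannEigenbasis V κ e) (n : ℕ) : C(I, ℝ) := (he.test n).secondC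

@[simp] lemma sC_apply (he : IsNeumannEigenbasis V κ e) (n : ℕ) (x : I) :
    he.sC n x = (V x - κ n) * e n x := by simp [sC]

include hV in
/-- Polynomial bounds for the eigenfunctions and their derivatives. -/
lemma exists_norm_le (he : IsNeumannEigenbasis V κ e) : ∃ K : ℝ,
    (∀ n, ‖he.eC n‖ ≤ K * κ n ^ 1) ∧ (∀ n, ‖he.dC n‖ ≤ K * κ n ^ 2) ∧
      ∀ n, ‖he.sC n‖ ≤ K * κ n ^ 2 := by
  obtain ⟨-, C, hC0, h1, h2⟩ := he.exists_bound hV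
  have hpos := he.eigenvalue_pos hV
  have hx : ∀ n (x : I), |e n x| ≤ C * κ n := fun n x => by
    refine abs_le_of_sq_le_sq ?_ (by linarith [h1 n])
    nlinarith [h2 n x, h1 n]
  have hs : ∀ n, ‖he.sC n‖ ≤ (‖V‖ * C + 1) * C * κ n ^ 2 := fun n => by
    have hκ := hpos n
    refine (ContinuousMap.norm_le _ (by positivity)).2 fun x => ?_
    rw [sC_apply, norm_mul]
    have h3 : ‖V x - κ n‖ ≤ (‖V‖ * C + 1) * κ n := by
      refine (norm_sub_le _ _).trans ?_
      have h4 := V.norm_coe_le_norm x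
      have h5 : ‖V‖ ≤ ‖V‖ * (C * κ n) := le_mul_of_one_le_right (norm_nonneg _) (h1 n)
      rw [Real.norm_of_nonneg hκ.le]
      nlinarith
    calc ‖V x - κ n‖ * ‖e n x‖ ≤ (‖V‖ * C + 1) * κ n * (C * κ n) :=
          mul_le_mul h3 (hx n x) (norm_nonneg _) (by positivity)
      _ = _ := by ring
  have hd : ∀ n, ‖he.dC n‖ ≤ (‖V‖ * C + 1) * C * κ n ^ 2 := fun n => by
    have hκ := hpos n
    refine (ContinuousMap.norm_le _ (by positivity)).2 fun x => ?_
    -- The derivative vanishes at `0`, so the bound for the second derivative carries over to it.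
    have h3 := Convex.norm_image_sub_le_of_norm_hasDerivWithin_le (s := Icc (0 : ℝ) 1)
      (he.test n).hasDeriv₂ (fun y hy => ?_) (convex_Icc _ _)
      (C := (‖V‖ * C + 1) * C * κ n ^ 2) (show (0 : ℝ) ∈ Icc (0 : ℝ) 1 by simp) x.2
    · rw [(he.test n).left, sub_zero, sub_zero, Real.norm_of_nonneg x.2.1] at h3
      exact h3.trans (mul_le_of_le_one_right (by positivity) x.2.2)
    · exact ((he.sC n).norm_coe_le_norm ⟨y, hy⟩).trans (hs n)
  refine ⟨max C ((‖V‖ * C + 1) * C), fun n => ?_, fun n => ?_, fun n => ?_⟩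
  · have hκ := hpos n
    rw [pow_one]
    refine le_trans ?_ (mul_le_mul_of_nonneg_right (le_max_left _ _) hκ.le)
    exact (ContinuousMap.norm_le _ (by positivity)).2 fun x => hx n x
  · exact (hd n).trans (mul_le_mul_of_nonneg_right (le_max_right _ _) (by positivity))
  · exact (hs n).trans (mul_le_mul_of_nonneg_right (le_max_right _ _) (by positivity))

include hV in
-- From `(κ t)^(k+1) / (k+1)! ≤ exp(κ t)`, each term is at most a constant times `1/κ n`, which is
-- summable.
lemma summable_pow_mul_exp (he : IsNeumannEigenbasis V κ e) (k : ℕ) {t : ℝ} (ht : 0 < t) :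
    Summable fun n => Real.exp (-(κ n * t)) * κ n ^ k := by
  have hpos := he.eigenvalue_pos hV
  refine Summable.of_nonneg_of_le (fun n => ?_) (fun n => ?_)
    ((he.exists_bound hV).1.mul_left ((k + 1).factorial / t ^ (k + 1)))
  · have := hpos n; positivity
  · have hκ := hpos n
    have h1 := Real.pow_div_factorial_le_exp (κ n * t) (by positivity) (k + 1)
    rw [Real.exp_neg, div_mul_eq_mul_div, le_div_iff₀ (by positivity), inv_mul_eq_div,
      div_mul_eq_mul_div, div_le_iff₀ (Real.exp_pos _), mul_comm _ (Real.exp _)]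
    rw [div_le_iff₀ (by positivity)] at h1
    have e1 : κ n ^ k * t ^ (k + 1) = (κ n * t) ^ (k + 1) * (κ n)⁻¹ := by
      rw [mul_pow, pow_succ (κ n)]; field_simp
    rw [e1, ← mul_assoc]
    exact mul_le_mul_of_nonneg_right h1 (by positivity)

/-! ### The linear heat semigroup -/

/-- The operator `f ↦ ∑ exp(-κ_n t) c_n(f) g_n` from `L²` to `C([0,1])`. -/
def series (he : IsNeumannEigenbasis V κ e) (g : ℕ → C(I, ℝ)) (t : ℝ) : L2I →L[ℝ] C(I, ℝ) :=
  ∑' n, (Real.exp (-(κ n * t)) • he.coord n).smulRight (g n)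

include hV in
-- The rank-one operators are summable in operator norm, so `series` is a genuine sum and not the
-- default value of `tsum`.
lemma hasSum_series (he : IsNeumannEigenbasis V κ e) {g : ℕ → C(I, ℝ)} {K : ℝ} {k : ℕ}
    (hg : ∀ n, ‖g n‖ ≤ K * κ n ^ k) {t : ℝ} (ht : 0 < t) (f : L2I) :
    HasSum (fun n => (Real.exp (-(κ n * t)) * he.coord n f) • g n) (he.series g t f) := by
  have hb : ∀ n, ‖(Real.exp (-(κ n * t)) • he.coord n).smulRight (g n)‖
      ≤ K * (Real.exp (-(κ n * t)) * κ n ^ k) := fun n => by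
    rw [ContinuousLinearMap.norm_smulRight_apply, norm_smul, Real.norm_of_nonneg (Real.exp_pos _).le]
    calc Real.exp (-(κ n * t)) * ‖he.coord n‖ * ‖g n‖
        ≤ Real.exp (-(κ n * t)) * 1 * (K * κ n ^ k) := by
          gcongr
          exacts [he.norm_coord_le n, hg n]
      _ = _ := by ring
  have hsum : Summable fun n => (Real.exp (-(κ n * t)) • he.coord n).smulRight (g n) :=
    Summable.of_norm_bounded (E := L2I →L[ℝ] C(I, ℝ))
      ((he.summable_pow_mul_exp hV k ht).mul_left K) hb
  have h1 := hsum.hasSum.mapL (ContinuousLinearMap.apply ℝ C(I, ℝ) f)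
  exact h1

include hV in
lemma series_apply (he : IsNeumannEigenbasis V κ e) {g : ℕ → C(I, ℝ)} {K : ℝ} {k : ℕ}
    (hg : ∀ n, ‖g n‖ ≤ K * κ n ^ k) {t : ℝ} (ht : 0 < t) (f : L2I) (x : I) :
    he.series g t f x = ∑' n, Real.exp (-(κ n * t)) * he.coord n f * g n x := by
  have h1 := (he.hasSum_series hV hg ht f).mapL (ContinuousMap.evalCLM ℝ x)
  simpa using h1.tsum_eq.symm

/-- The linear heat semigroup generated by `∂ₓₓ - V`, for positive times. -/
def heat (he : IsNeumannEigenbasis V κ e) (t : ℝ) : L2I →L[ℝ] C(I, ℝ) := he.series he.eC t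

/-- The space derivative of the linear heat semigroup, for positive times. -/
def heatDeriv (he : IsNeumannEigenbasis V κ e) (t : ℝ) : L2I →L[ℝ] C(I, ℝ) := he.series he.dC t

include hV in
lemma heat_apply (he : IsNeumannEigenbasis V κ e) {t : ℝ} (ht : 0 < t) (f : L2I) (x : I) :
    he.heat t f x = ∑' n, Real.exp (-(κ n * t)) * he.coord n f * e n x := by
  obtain ⟨K, h, -, -⟩ := he.exists_norm_le hV
  exact he.series_apply hV h ht f x

include hV in
lemma heatDeriv_apply (he : IsNeumannEigenbasis V κ e) {t : ℝ} (ht : 0 < t) (f : L2I) (x : I) :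
    he.heatDeriv t f x = ∑' n, Real.exp (-(κ n * t)) * he.coord n f * he.deriv n x := by
  obtain ⟨K, -, h, -⟩ := he.exists_norm_le hV
  exact he.series_apply hV h ht f x

include hV in
lemma coord_heat (he : IsNeumannEigenbasis V κ e) {t : ℝ} (ht : 0 < t) (f : L2I) (m : ℕ) :
    he.coord m (classL2 (he.heat t f)) = Real.exp (-(κ m * t)) * he.coord m f := by
  obtain ⟨K, h, -, -⟩ := he.exists_norm_le hV
  have h1 := (he.hasSum_series hV h ht f).mapL ((he.coord m).comp classL2)
  refine h1.tsum_eq.symm.trans ?_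
  rw [tsum_eq_single m]
  · simp [coord_basis]
  · intro n hn
    simp [coord_basis, hn.symm]

include hV in
/-- For positive times the values of the semigroup are `C²` and satisfy the Neumann conditions. -/
lemma heat_test (he : IsNeumannEigenbasis V κ e) {t : ℝ} (ht : 0 < t) (f : L2I) :
    IsNeumannTest (fun x => ∑' n, Real.exp (-(κ n * t)) * he.coord n f * e n x)
      (fun x => ∑' n, Real.exp (-(κ n * t)) * he.coord n f * he.deriv n x)
      (fun x => ∑' n, Real.exp (-(κ n * t)) * he.coord n f *
        ((extendPotential V x - κ n) * e n x)) := by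
  obtain ⟨K, h₀, h₁, h₂⟩ := he.exists_norm_le hV
  set a : ℕ → ℝ := fun n => Real.exp (-(κ n * t)) * he.coord n f with ha
  have hsum : ∀ k, Summable fun n => ‖f‖ * K * (Real.exp (-(κ n * t)) * κ n ^ k) := fun k =>
    (he.summable_pow_mul_exp hV k ht).mul_left _
  have hb : ∀ {k : ℕ} {n : ℕ} {r : ℝ}, |r| ≤ K * κ n ^ k →
      |a n * r| ≤ ‖f‖ * K * (Real.exp (-(κ n * t)) * κ n ^ k) := by
    intro k n r hr
    rw [ha, abs_mul, abs_mul, abs_of_pos (Real.exp_pos _)]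
    calc Real.exp (-(κ n * t)) * |he.coord n f| * |r|
        ≤ Real.exp (-(κ n * t)) * ‖f‖ * (K * κ n ^ k) := by
          gcongr
          exact he.abs_coord_le n f
      _ = _ := by ring
  have b₀ : ∀ n, ∀ x ∈ Icc (0 : ℝ) 1, |e n x| ≤ K * κ n ^ 1 := fun n x hx =>
    ((he.eC n).norm_coe_le_norm ⟨x, hx⟩).trans (h₀ n)
  have b₁ : ∀ n, ∀ x ∈ Icc (0 : ℝ) 1, |he.deriv n x| ≤ K * κ n ^ 2 := fun n x hx =>
    ((he.dC n).norm_coe_le_norm ⟨x, hx⟩).trans (h₁ n)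
  have b₂ : ∀ n, ∀ x ∈ Icc (0 : ℝ) 1, |(extendPotential V x - κ n) * e n x| ≤ K * κ n ^ 2 :=
    fun n x hx => ((he.sC n).norm_coe_le_norm ⟨x, hx⟩).trans (h₂ n)
  have h0 : (0 : ℝ) ∈ Icc (0 : ℝ) 1 := by simp
  refine ⟨fun x hx => ?_, fun x hx => ?_, ?_, ?_, ?_⟩
  · exact hasDerivWithinAt_tsum_Icc (hsum 2)
      (fun n x hx => ((he.test n).hasDeriv₁ x hx).const_mul (a n))
      (fun n => continuousOn_const.mul (he.test n).continuousOn₁) (fun n x hx => hb (b₁ n x hx))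
      (Summable.of_norm_bounded (hsum 1) fun n => hb (b₀ n 0 h0)) hx
  · exact hasDerivWithinAt_tsum_Icc (hsum 2)
      (fun n x hx => ((he.test n).hasDeriv₂ x hx).const_mul (a n))
      (fun n => continuousOn_const.mul (he.test n).continuousOn) (fun n x hx => hb (b₂ n x hx))
      (Summable.of_norm_bounded (hsum 2) fun n => hb (b₁ n 0 h0)) hx
  · exact continuousOn_tsum (fun n => continuousOn_const.mul (he.test n).continuousOn) (hsum 2)
      fun n x hx => hb (b₂ n x hx)
  · simp [(he.test _).left]
  · simp [(he.test _).right]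

include hV in
/-- For a Neumann test function the eigenfunction expansion converges absolutely and uniformly. -/
lemma summable_coord_mul_norm (he : IsNeumannEigenbasis V κ e) {φ φ₁ φ₂ : ℝ → ℝ}
    (h : IsNeumannTest φ φ₁ φ₂) :
    Summable fun n => |he.coord n (classL2 h.toC)| * ‖he.eC n‖ := by
  obtain ⟨hs, C, hC0, -, h2⟩ := he.exists_bound hV
  -- The coefficient is `-d / κ n` with `d` the coefficient of `φ'' - Vφ`. Both `d` and `‖e n‖ / κ
  -- n` are square summable, and the product is bounded by the sum of squares.
  refine Summable.of_nonneg_of_le (fun n => by positivity) (fun n => ?_)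
    ((he.summable_coord_sq (classL2 (h.opC V))).add (hs.mul_left C))
  have hκ := he.eigenvalue_pos hV n
  have h3 : ‖he.eC n‖ ^ 2 ≤ C * κ n := by
    have : ‖he.eC n‖ ≤ √(C * κ n) :=
      (ContinuousMap.norm_le _ (Real.sqrt_nonneg _)).2 fun x => Real.abs_le_sqrt (h2 n x)
    calc ‖he.eC n‖ ^ 2 ≤ √(C * κ n) ^ 2 := by gcongr
      _ = C * κ n := Real.sq_sqrt (by positivity)
  have h4 := he.coord_opC h n
  set c := he.coord n (classL2 h.toC)
  set d := he.coord n (classL2 (h.opC V))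
  set r := ‖he.eC n‖
  have h5 : |c| = |d| * (κ n)⁻¹ := by
    rw [h4, abs_mul, abs_neg, abs_of_pos hκ]; field_simp
  have h6 : (r * (κ n)⁻¹) ^ 2 ≤ C * (κ n)⁻¹ := by
    rw [mul_pow]
    calc r ^ 2 * (κ n)⁻¹ ^ 2 ≤ C * κ n * (κ n)⁻¹ ^ 2 := by gcongr
      _ = C * (κ n)⁻¹ := by field_simp
  calc |c| * r = |d| * (r * (κ n)⁻¹) := by rw [h5]; ring
    _ ≤ |d| ^ 2 + (r * (κ n)⁻¹) ^ 2 := by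
      nlinarith [sq_nonneg (|d| - r * (κ n)⁻¹), sq_nonneg (|d| + r * (κ n)⁻¹)]
    _ ≤ d ^ 2 + C * (κ n)⁻¹ := by rw [sq_abs]; gcongr

include hV in
-- The uniform limit has the coordinates of `φ`, hence is `φ`. The heat series thus attains its
-- initial value pointwise, as the maximum principle requires.
lemma tsum_coord_mul (he : IsNeumannEigenbasis V κ e) {φ φ₁ φ₂ : ℝ → ℝ}
    (h : IsNeumannTest φ φ₁ φ₂) (x : I) :
    ∑' n, he.coord n (classL2 h.toC) * e n x = φ x := by
  have hs : Summable fun n => he.coord n (classL2 h.toC) • he.eC n := by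
    refine Summable.of_norm ((he.summable_coord_mul_norm hV h).congr fun n => ?_)
    rw [norm_smul, Real.norm_eq_abs]
  have e1 : ∑' n, he.coord n (classL2 h.toC) • he.eC n = h.toC := by
    apply ContinuousMap.toLp_injective (p := 2) (𝕜 := ℝ) (volume : Measure I)
    refine he.ext_coord fun m => ?_
    have h1 := hs.hasSum.mapL ((he.coord m).comp classL2)
    refine h1.tsum_eq.symm.trans ?_
    rw [tsum_eq_single m]
    · simp [coord_basis]
    · intro n hn
      simp [coord_basis, hn.symm]
  have h2 := hs.hasSum.mapL (ContinuousMap.evalCLM ℝ x)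
  rw [e1] at h2
  simpa using h2.tsum_eq

include hV in
lemma hasDerivWithinAt_heat_time (he : IsNeumannEigenbasis V κ e) (f : L2I) {s T : ℝ}
    (hs : s ∈ Ioc 0 T) (x : I) :
    HasDerivWithinAt (fun s => ∑' n, Real.exp (-(κ n * s)) * he.coord n f * e n x)
      (∑' n, Real.exp (-(κ n * s)) * (-κ n) * he.coord n f * e n x) (Icc 0 T) s := by
  have hpos := he.eigenvalue_pos hV
  obtain ⟨K, h₀, -, -⟩ := he.exists_norm_le hV
  have h4 : ∀ n, |e n x| ≤ K * κ n ^ 1 := fun n => ((he.eC n).norm_coe_le_norm x).trans (h₀ n)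
  -- Domination of the differentiated series fails to be uniform near time `0`; on `[s/2, T]` the
  -- factor `exp(-κ n s/2)` suffices.
  have hs2 : 0 < s / 2 := by linarith [hs.1]
  have hmem : Icc (s / 2) T ∈ 𝓝[Icc 0 T] s := by
    have : Ioi (s / 2) ∈ 𝓝 s := Ioi_mem_nhds (by linarith [hs.1])
    filter_upwards [mem_nhdsWithin_of_mem_nhds this, self_mem_nhdsWithin] with r hr hr'
    exact ⟨le_of_lt hr, hr'.2⟩
  have hd : ∀ n, ∀ r ∈ Icc (s / 2) T, HasDerivWithinAt
      (fun s => Real.exp (-(κ n * s)) * he.coord n f * e n x)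
      (Real.exp (-(κ n * r)) * (-κ n) * he.coord n f * e n x) (Icc (s / 2) T) r := fun n r _ => by
    have := (((hasDerivAt_id r).const_mul (κ n)).fun_neg.exp).mul_const (he.coord n f)
      |>.mul_const (e n x)
    simpa using this.hasDerivWithinAt
  have hb : ∀ n, ∀ r ∈ Icc (s / 2) T, |Real.exp (-(κ n * r)) * (-κ n) * he.coord n f * e n x|
      ≤ ‖f‖ * K * (Real.exp (-(κ n * (s / 2))) * κ n ^ 2) := fun n r hr => by
    have hκ := hpos n
    have h3 : Real.exp (-(κ n * r)) ≤ Real.exp (-(κ n * (s / 2))) := by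
      rw [Real.exp_le_exp]; nlinarith [hr.1]
    rw [abs_mul, abs_mul, abs_mul, abs_of_pos (Real.exp_pos _), abs_neg, abs_of_pos hκ]
    calc Real.exp (-(κ n * r)) * κ n * |he.coord n f| * |e n x|
        ≤ Real.exp (-(κ n * (s / 2))) * κ n * ‖f‖ * (K * κ n ^ 1) := by
          gcongr
          exacts [he.abs_coord_le n _, h4 n]
      _ = _ := by ring
  have hsum : Summable fun n => Real.exp (-(κ n * (s / 2))) * he.coord n f * e n x :=
    ((he.hasSum_series hV h₀ hs2 f).mapL (ContinuousMap.evalCLM ℝ x)).summable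
  exact (hasDerivWithinAt_tsum_Icc ((he.summable_pow_mul_exp hV 2 hs2).mul_left _) hd
    (fun n => by fun_prop) hb hsum ⟨by linarith, hs.2⟩).mono_of_mem_nhdsWithin hmem

include hV in
/-- Lower bound for the heat flow of a Neumann test function. -/
lemma le_heat_of_test (he : IsNeumannEigenbasis V κ e) {φ φ₁ φ₂ : ℝ → ℝ}
    (h : IsNeumannTest φ φ₁ φ₂) {δ : ℝ} (hδ0 : 0 ≤ δ) (hδ : ∀ x : I, δ ≤ φ x) {t : ℝ}
    (ht : 0 < t) (x : I) :
    δ * Real.exp (-(‖V‖ * t)) ≤ he.heat t (classL2 h.toC) x := by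
  set c : ℕ → ℝ := fun n => he.coord n (classL2 h.toC) with hc
  have hpos := he.eigenvalue_pos hV
  obtain ⟨K, h₀, h₁, h₂⟩ := he.exists_norm_le hV
  have hex : ∀ x : ℝ, HasDerivAt (fun t => δ * Real.exp (-(‖V‖ * t)))
      (δ * (Real.exp (-(‖V‖ * x)) * -(‖V‖))) x := fun x => by
    have := (((hasDerivAt_id x).const_mul ‖V‖).neg.exp).const_mul δ
    simpa using this
  -- The comparison function `δ exp(-‖V‖ t)` is constant in space and a subsolution because `V ≤
  -- ‖V‖`.
  have key := parabolic_maximum_principle hV ht.le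
    (y := fun s x => (∑' n, Real.exp (-(κ n * s)) * c n * e n x) - δ * Real.exp (-(‖V‖ * s)))
    (yt := fun s x => (∑' n, Real.exp (-(κ n * s)) * (-κ n) * c n * e n x)
      - δ * (Real.exp (-(‖V‖ * s)) * -(‖V‖)))
    (y₁ := fun s x => ∑' n, Real.exp (-(κ n * s)) * c n * he.deriv n x)
    (y₂ := fun s x => ∑' n, Real.exp (-(κ n * s)) * c n * ((extendPotential V x - κ n) * e n x))
    ?_ ?_ ?_ ?_ ?_ t ⟨ht.le, le_rfl⟩ x x.2
  · rw [he.heat_apply hV ht]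
    exact sub_nonneg.1 key
  · refine ContinuousOn.sub ?_ (by fun_prop)
    refine continuousOn_tsum (fun n => ?_) (he.summable_coord_mul_norm hV h) fun n p hp => ?_
    · refine ContinuousOn.mul (by fun_prop) ?_
      exact (he.test n).continuousOn₀.comp continuousOn_snd fun p hp => hp.2
    · rw [norm_mul, norm_mul, Real.norm_of_nonneg (Real.exp_pos _).le]
      have h3 : Real.exp (-(κ n * p.1)) ≤ 1 := by
        rw [Real.exp_le_one_iff]
        have := mul_nonneg (hpos n).le hp.1.1
        linarith
      have h4 : ‖e n p.2‖ ≤ ‖he.eC n‖ := (he.eC n).norm_coe_le_norm ⟨p.2, hp.2⟩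
      calc Real.exp (-(κ n * p.1)) * ‖c n‖ * ‖e n p.2‖ ≤ 1 * ‖c n‖ * ‖he.eC n‖ := by gcongr
        _ = |c n| * ‖he.eC n‖ := by rw [one_mul, Real.norm_eq_abs]
  · intro x hx
    have := he.tsum_coord_mul hV h ⟨x, hx⟩
    simp only at this
    simp only [mul_zero, neg_zero, Real.exp_zero, one_mul, mul_one, hc, this]
    exact sub_nonneg.2 (hδ ⟨x, hx⟩)
  · intro s hs x hx
    exact (he.hasDerivWithinAt_heat_time hV (classL2 h.toC) hs ⟨x, hx⟩).fun_sub
      (hex s).hasDerivWithinAt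
  · intro s hs
    have h3 := (he.heat_test hV hs.1 (classL2 h.toC)).add
      (IsNeumannTest.const (-(δ * Real.exp (-(‖V‖ * s)))))
    simpa [sub_eq_add_neg] using h3
  · intro s hs x
    have hsum1 := (he.hasSum_series hV h₀ hs.1 (classL2 h.toC)).mapL (ContinuousMap.evalCLM ℝ x)
    have hsum2 := (he.hasSum_series hV h₂ hs.1 (classL2 h.toC)).mapL (ContinuousMap.evalCLM ℝ x)
    simp only [ContinuousMap.evalCLM_apply, ContinuousMap.smul_apply, smul_eq_mul, eC_apply,
      sC_apply] at hsum1 hsum2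
    have e3 : ∑' n, Real.exp (-(κ n * s)) * (-κ n) * c n * e n x
        = (∑' n, Real.exp (-(κ n * s)) * c n * ((V x - κ n) * e n x))
          - V x * ∑' n, Real.exp (-(κ n * s)) * c n * e n x := by
      rw [← tsum_mul_left, ← hsum2.summable.tsum_sub (hsum1.summable.mul_left (V x))]
      exact tsum_congr fun n => by ring
    simp only [extendPotential_coe, e3]
    have h5 : V x ≤ ‖V‖ := (le_abs_self _).trans (V.norm_coe_le_norm x)
    have h6 : 0 ≤ δ * Real.exp (-(‖V‖ * s)) := by positivity
    nlinarith

end IsNeumannEigenbasis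

/-! ### Density of Neumann test functions -/

/-- Polynomials in `cos (π x)` are Neumann test functions. -/
lemma isNeumannTest_polynomial_cos (p : Polynomial ℝ) :
    IsNeumannTest (fun x => p.eval (Real.cos (Real.pi * x)))
      (fun x => p.derivative.eval (Real.cos (Real.pi * x)) * (-Real.sin (Real.pi * x) * Real.pi))
      (fun x => p.derivative.derivative.eval (Real.cos (Real.pi * x)) *
          (-Real.sin (Real.pi * x) * Real.pi) * (-Real.sin (Real.pi * x) * Real.pi) +
        p.derivative.eval (Real.cos (Real.pi * x)) *
          (-(Real.cos (Real.pi * x) * Real.pi) * Real.pi)) := by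
  have hcos : ∀ x : ℝ, HasDerivAt (fun x => Real.cos (Real.pi * x))
      (-Real.sin (Real.pi * x) * Real.pi) x := fun x => by
    simpa using ((hasDerivAt_id x).const_mul Real.pi).cos
  have hsin : ∀ x : ℝ, HasDerivAt (fun x => -Real.sin (Real.pi * x) * Real.pi)
      (-(Real.cos (Real.pi * x) * Real.pi) * Real.pi) x := fun x => by
    simpa using (((hasDerivAt_id x).const_mul Real.pi).sin).fun_neg.mul_const Real.pi
  have hp : ∀ (q : Polynomial ℝ) (x : ℝ), HasDerivAt (fun x => q.eval (Real.cos (Real.pi * x)))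
      (q.derivative.eval (Real.cos (Real.pi * x)) * (-Real.sin (Real.pi * x) * Real.pi)) x :=
    fun q x => (q.hasDerivAt _).comp x (hcos x)
  refine ⟨fun x _ => (hp p x).hasDerivWithinAt,
    fun x _ => ((hp _ x).fun_mul (hsin x)).hasDerivWithinAt, ?_, by simp, by simp⟩
  have hc : ∀ q : Polynomial ℝ, Continuous fun x : ℝ => q.eval (Real.cos (Real.pi * x)) :=
    fun q => q.continuous.comp (by fun_prop)
  exact (((hc _).mul (by fun_prop)).mul (by fun_prop)
    |>.add ((hc _).mul (by fun_prop))).continuousOn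

/-- Neumann test functions bounded below by `δ` are dense among the continuous functions bounded
below by `δ`. -/
lemma mem_closure_neumannTest (v : C(I, ℝ)) {δ : ℝ} (hδ : ∀ x, δ ≤ v x) :
    v ∈ closure {w : C(I, ℝ) | (∀ x, δ ≤ w x) ∧
      ∃ (φ φ₁ φ₂ : ℝ → ℝ) (h : IsNeumannTest φ φ₁ φ₂), w = h.toC} := by
  rw [Metric.mem_closure_iff]
  intro ε hε
  -- The substitution `y = cos (π x)` reduces the claim to Weierstrass approximation on `[-1, 1]`.
  -- Approximating `v + ε/2` within `ε/2` keeps the polynomial above `v`, hence above `δ`.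
  have hcont : Continuous fun y : ℝ => IccExtend zero_le_one v (Real.arccos y / Real.pi) + ε / 2 :=
    ((v.continuous.Icc_extend').comp (Real.continuous_arccos.div_const _)).add continuous_const
  obtain ⟨p, hp⟩ := exists_polynomial_near_of_continuousOn (-1) 1 _ hcont.continuousOn (ε / 2)
    (by linarith)
  have hx : ∀ x : I, |p.eval (Real.cos (Real.pi * x)) - (v x + ε / 2)| < ε / 2 := fun x => by
    have h1 := hp (Real.cos (Real.pi * x)) ⟨Real.neg_one_le_cos _, Real.cos_le_one _⟩
    have h2 : Real.arccos (Real.cos (Real.pi * x)) / Real.pi = x := by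
      rw [Real.arccos_cos (mul_nonneg Real.pi_pos.le x.2.1)
        (mul_le_of_le_one_right Real.pi_pos.le x.2.2), mul_div_cancel_left₀ _ Real.pi_ne_zero]
    rwa [h2, IccExtend_val] at h1
  refine ⟨(isNeumannTest_polynomial_cos p).toC, ⟨fun x => ?_, _, _, _, _, rfl⟩, ?_⟩
  · have := (abs_lt.1 (hx x)).1
    have := hδ x
    simp only [IsNeumannTest.toC_apply]
    linarith
  · rw [ContinuousMap.dist_lt_iff hε]
    intro x
    have := abs_lt.1 (hx x)
    rw [Real.dist_eq, IsNeumannTest.toC_apply, abs_lt]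
    constructor <;> linarith

/-! ### Positivity of the semigroup and of the ground state -/

namespace IsNeumannEigenbasis

variable {V : C(I, ℝ)} {κ : ℕ → ℝ} {e : ℕ → ℝ → ℝ} (hV : ∀ x, 0 < V x)

include hV in
/-- Lower bound for the heat flow of a continuous function. -/
lemma le_heat (he : IsNeumannEigenbasis V κ e) {v : C(I, ℝ)} {δ : ℝ} (hδ0 : 0 ≤ δ)
    (hδ : ∀ x, δ ≤ v x) {t : ℝ} (ht : 0 < t) (x : I) :
    δ * Real.exp (-(‖V‖ * t)) ≤ he.heat t (classL2 v) x := by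
  have hcont : Continuous fun w : C(I, ℝ) => he.heat t (classL2 w) x :=
    (ContinuousMap.evalCLM ℝ x).continuous.comp
      ((he.heat t).continuous.comp classL2.continuous)
  have hcl : IsClosed {w : C(I, ℝ) | δ * Real.exp (-(‖V‖ * t)) ≤ he.heat t (classL2 w) x} :=
    isClosed_le continuous_const hcont
  refine closure_minimal ?_ hcl (mem_closure_neumannTest v hδ)
  rintro w ⟨hw, φ, φ₁, φ₂, h, rfl⟩
  exact he.le_heat_of_test hV h hδ0 hw ht x

include hV in
lemma heat_pos (he : IsNeumannEigenbasis V κ e) (v : P1) {t : ℝ} (ht : 0 < t) (x : I) :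
    0 < he.heat t v.toL2 x := by
  obtain ⟨x₀, -, hx₀⟩ := isCompact_univ.exists_isMinOn univ_nonempty
    v.toC.continuous.continuousOn
  have h1 := he.le_heat hV (v.pos x₀).le (fun y => hx₀ (mem_univ y)) ht x
  exact (mul_pos (v.pos x₀) (Real.exp_pos _)).trans_le h1

/-- An eigenfunction does not vanish identically. -/
lemma exists_ne_zero (he : IsNeumannEigenbasis V κ e) (n : ℕ) : ∃ x : I, e n x ≠ 0 := by
  by_contra! h
  have := he.orthonormal n n
  simp [h] at this

/-- The smallest eigenvalue is simple. -/
lemma eigenvalue_zero_lt (he : IsNeumannEigenbasis V κ e) {n : ℕ} (hn : n ≠ 0) : κ 0 < κ n := by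
  refine (he.mono (Nat.zero_le n)).lt_of_ne fun hκ => ?_
  have hq : ContinuousOn (fun x => extendPotential V x - κ 0) (Icc 0 1) :=
    ((continuous_extendPotential V).sub continuous_const).continuousOn
  -- If the eigenvalues coincide, a combination vanishing at `0` has zero Cauchy data there. So `e
  -- 0` and `e n` are proportional, against orthogonality.
  have ht : ∀ a b : ℝ, a * e 0 0 + b * e n 0 = 0 →
      ∀ x ∈ Icc (0 : ℝ) 1, a * e 0 x + b * e n x = 0 := by
    intro a b h0
    have h := ((he.test 0).const_mul a).add ((he.test n).const_mul b)
    refine eq_zero_of_cauchy_data_zero hq h.hasDeriv₁ (fun x hx => ?_) h0 h.left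
    refine (h.hasDeriv₂ x hx).congr_deriv ?_
    rw [← hκ]; ring
  have h1 : ∀ x : I, e n 0 * e 0 x = e 0 0 * e n x := fun x => by
    have := ht (e n 0) (-e 0 0) (by ring) x x.2
    linarith
  have h2 : e n 0 = 0 := by
    have e1 : ∫ x : I, (e n 0 * e 0 x) * e 0 x = ∫ x : I, (e 0 0 * e n x) * e 0 x := by
      simp only [h1]
    simp only [mul_assoc, integral_const_mul, he.orthonormal] at e1
    simpa [hn] using e1
  obtain ⟨x, hx⟩ := he.exists_ne_zero n
  exact hx (by simpa using ht 0 1 (by simp [h2]) x x.2)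

include hV in
-- `exp(κ 0 t) S(t)φ` is nonnegative and tends to `c_0(φ) e_0` as `t → ∞`, since all other modes
-- decay; dominated convergence uses the absolutely convergent expansion of `φ`.
lemma coord_zero_mul_nonneg (he : IsNeumannEigenbasis V κ e) {φ φ₁ φ₂ : ℝ → ℝ}
    (h : IsNeumannTest φ φ₁ φ₂) (hφ : ∀ x : I, 0 ≤ φ x) (x : I) :
    0 ≤ he.coord 0 (classL2 h.toC) * e 0 x := by
  set c : ℕ → ℝ := fun n => he.coord n (classL2 h.toC) with hc
  have hlim : Tendsto (fun t : ℝ => ∑' n, Real.exp (-((κ n - κ 0) * t)) * (c n * e n x)) atTop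
      (𝓝 (∑' n, if n = 0 then c 0 * e 0 x else 0)) := by
    refine tendsto_tsum_of_dominated_convergence (he.summable_coord_mul_norm hV h) (fun n => ?_) ?_
    · by_cases hn : n = 0
      · subst hn; simp
      · have h1 : Tendsto (fun t : ℝ => (κ n - κ 0) * t) atTop atTop :=
          tendsto_id.const_mul_atTop (sub_pos.2 (he.eigenvalue_zero_lt hn))
        simpa [hn] using (Real.tendsto_exp_neg_atTop_nhds_zero.comp h1).mul_const (c n * e n x)
    · filter_upwards [eventually_ge_atTop 0] with t ht n
      have h2 : Real.exp (-((κ n - κ 0) * t)) ≤ 1 := by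
        rw [Real.exp_le_one_iff]
        have := mul_nonneg (sub_nonneg.2 (he.mono (Nat.zero_le n))) ht
        linarith
      have h3 : ‖e n x‖ ≤ ‖he.eC n‖ := (he.eC n).norm_coe_le_norm x
      rw [norm_mul, norm_mul, Real.norm_of_nonneg (Real.exp_pos _).le]
      calc Real.exp (-((κ n - κ 0) * t)) * (‖c n‖ * ‖e n x‖) ≤ 1 * (‖c n‖ * ‖he.eC n‖) := by gcongr
        _ = |c n| * ‖he.eC n‖ := by rw [one_mul, Real.norm_eq_abs]
  rw [tsum_ite_eq] at hlim
  refine ge_of_tendsto hlim ?_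
  filter_upwards [eventually_gt_atTop 0] with t ht
  have h4 := he.le_heat_of_test hV h le_rfl hφ ht x
  rw [zero_mul, he.heat_apply hV ht] at h4
  have h5 : ∑' n, Real.exp (-((κ n - κ 0) * t)) * (c n * e n x)
      = Real.exp (κ 0 * t) * ∑' n, Real.exp (-(κ n * t)) * c n * e n x := by
    rw [← tsum_mul_left]
    refine tsum_congr fun n => ?_
    rw [show -((κ n - κ 0) * t) = κ 0 * t + -(κ n * t) by ring, Real.exp_add]
    ring
  rw [h5]
  exact mul_nonneg (Real.exp_pos _).le h4

include hV in
/-- The ground state is nonnegative. -/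
lemma ground_nonneg (he : IsNeumannEigenbasis V κ e) (x : I) : 0 ≤ e 0 x := by
  -- The sign convention alone allows `∫ e 0 = 0`. In that case the nonnegative function `e 0 + ‖e
  -- 0‖` still has coefficient `1`.
  rcases he.sign.eq_or_lt with h0 | hpos
  · have h := (he.test 0).add (IsNeumannTest.const ‖he.eC 0‖)
    have h1 := he.coord_zero_mul_nonneg hV h (fun x => by
      have := neg_le_of_abs_le ((he.eC 0).norm_coe_le_norm x)
      simp only [eC_apply] at this
      linarith) x
    have h2 : he.coord 0 (classL2 h.toC) = 1 := by
      have e1 : h.toC = he.eC 0 + ‖he.eC 0‖ • (1 : C(I, ℝ)) := by ext y; simp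
      rw [e1, map_add, map_add, coord_basis, map_smul, map_smul, coord_classL2]
      simp [← h0]
    rwa [h2, one_mul] at h1
  · have h1 := he.coord_zero_mul_nonneg hV (IsNeumannTest.const 1) (fun _ => zero_le_one) x
    rw [coord_classL2] at h1
    simp only [IsNeumannTest.toC_apply, mul_one] at h1
    exact nonneg_of_mul_nonneg_right h1 hpos

include hV in
-- It is enough that `e 0` is nonnegative and nonzero somewhere, because `v` is strictly positive.
lemma coeff_zero_pos (he : IsNeumannEigenbasis V κ e) (v : P1) : 0 < coeff e 0 v := by
  obtain ⟨x, hx⟩ := he.exists_ne_zero 0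
  exact ContinuousMap.integral_pos_unitInterval (g := he.eC 0 * v.toC)
    (fun y => mul_nonneg (he.ground_nonneg hV y) (v.pos y).le) (x₀ := x)
    (mul_ne_zero hx (v.pos x).ne')

end IsNeumannEigenbasis

/-! ### Weak derivatives and normalization in `P1` -/

lemma IsNeumannTest.isWeakDeriv {φ φ₁ φ₂ : ℝ → ℝ} (h : IsNeumannTest φ φ₁ φ₂) :
    IsWeakDeriv h.toC (classL2 h.derivC) := by
  intro η hη hcs hsupp
  have hη0 : ∀ x, x ∉ Ioo (0 : ℝ) 1 → η x = 0 := fun x hx =>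
    image_eq_zero_of_notMem_tsupport fun hx' => hx (hsupp hx')
  have hdiff : ∀ x, HasDerivAt η (_root_.deriv η x) x := fun x =>
    (hη.differentiable (by simp)).differentiableAt.hasDerivAt
  have hdc : Continuous (_root_.deriv η) := hη.continuous_deriv (by simp)
  have key := integral_eq_sub_of_hasDerivWithinAt_Icc zero_le_one
    (f := fun x => φ x * η x) (f' := fun x => φ₁ x * η x + φ x * _root_.deriv η x)
    (fun x hx => (h.hasDeriv₁ x hx).fun_mul (hdiff x).hasDerivWithinAt)
    ((h.continuousOn₁.mul hη.continuous.continuousOn).add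
      (h.continuousOn₀.mul hdc.continuousOn))
  rw [hη0 0 (by simp), hη0 1 (by simp), ← integral_unitInterval_coe] at key
  have i1 := (h.derivC * ⟨fun x => η x, hη.continuous.comp continuous_subtype_val⟩ :
    C(I, ℝ)).integrable_unitInterval
  have i2 := (h.toC * ⟨fun x => _root_.deriv η x, hdc.comp continuous_subtype_val⟩ :
    C(I, ℝ)).integrable_unitInterval
  have e1 := (integral_add i1 i2).symm.trans key
  have e2 : ∫ x : I, classL2 h.derivC x * η x = ∫ x : I, φ₁ x * η x := by
    refine integral_congr_ae ?_
    filter_upwards [classL2_ae h.derivC] with x hx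
    rw [hx, h.derivC_apply]
  rw [e2]
  simp only [mul_zero, sub_self] at e1
  exact eq_neg_of_add_eq_zero_right e1

lemma Lp.integrable_unitInterval (f : L2I) : Integrable (fun x : I => f x) :=
  (Lp.memLp f).integrable (by norm_num)

/-- The fundamental lemma of the calculus of variations on the open interval. Since `P1.weakDeriv`
is a choice, only uniqueness allows it to be computed. -/
lemma IsWeakDeriv.unique {v : C(I, ℝ)} {g₁ g₂ : L2I} (h₁ : IsWeakDeriv v g₁)
    (h₂ : IsWeakDeriv v g₂) : g₁ = g₂ := by
  set d : I → ℝ := fun x => g₁ x - g₂ x with hd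
  have hdi : Integrable d := (Lp.integrable_unitInterval g₁).sub (Lp.integrable_unitInterval g₂)
  set F : ℝ → ℝ := IccExtend zero_le_one d with hF
  have hFd : ∀ x : I, F x = d x := fun x => IccExtend_val _ _ x
  have hFi : IntegrableOn F (Icc 0 1) := by
    rw [IntegrableOn, ← map_comap_subtype_coe measurableSet_Icc,
      (MeasurableEmbedding.subtype_coe measurableSet_Icc).integrable_map_iff]
    exact hdi.congr (ae_of_all _ fun x => (hFd x).symm)
  have key := isOpen_Ioo.ae_eq_zero_of_integral_contDiff_smul_eq_zero (U := Ioo (0 : ℝ) 1)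
    (μ := volume) (f := F) ((hFi.mono_set Ioo_subset_Icc_self).locallyIntegrableOn) ?_
  · have h0 : ∀ᵐ x : ℝ, x ≠ 0 ∧ x ≠ 1 := by
      have a0 : ∀ᵐ x : ℝ, x ≠ 0 := by simp [ae_iff]
      have a1 : ∀ᵐ x : ℝ, x ≠ 1 := by simp [ae_iff]
      exact a0.and a1
    have h3 : ∀ᵐ x ∂(volume.restrict (Icc (0 : ℝ) 1)), F x = 0 := by
      rw [ae_restrict_iff' measurableSet_Icc]
      filter_upwards [key, h0] with x hx h0 hxI
      exact hx ⟨hxI.1.lt_of_ne h0.1.symm, hxI.2.lt_of_ne h0.2⟩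
    rw [← map_comap_subtype_coe measurableSet_Icc,
      (MeasurableEmbedding.subtype_coe measurableSet_Icc).ae_map_iff] at h3
    refine Lp.ext ?_
    have h4 : ∀ᵐ x : I, F x = 0 := h3
    filter_upwards [h4] with x hx
    rw [hFd] at hx
    exact sub_eq_zero.1 hx
  · intro η hη hcs hsupp
    have hb : ∃ C, ∀ x, ‖η x‖ ≤ C := hη.continuous.bounded_above_of_compact_support hcs
    obtain ⟨C, hC⟩ := hb
    have im : ∀ g : L2I, Integrable fun x : I => g x * η x := fun g =>
      (Lp.integrable_unitInterval g).mul_bdd (c := C)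
        (hη.continuous.comp continuous_subtype_val).aestronglyMeasurable
        (ae_of_all _ fun x => hC x)
    have e1 : ∫ x : I, g₁ x * η x = ∫ x : I, g₂ x * η x := by
      have a1 := h₁ η hη hcs hsupp
      have a2 := h₂ η hη hcs hsupp
      linarith
    have e2 : ∫ x : I, η x * F x = 0 := by
      have : ∫ x : I, η x * F x = ∫ x : I, (g₁ x * η x - g₂ x * η x) :=
        integral_congr_ae (ae_of_all _ fun x => by simp only [hFd, hd]; ring)
      rw [this, integral_sub (im g₁) (im g₂), e1, sub_self]
    have e3 : ∫ x, η x • F x = ∫ x in Icc (0 : ℝ) 1, η x * F x := by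
      refine (setIntegral_eq_integral_of_forall_compl_eq_zero fun x hx => ?_).symm
      rw [image_eq_zero_of_notMem_tsupport fun hx' => hx (Ioo_subset_Icc_self (hsupp hx')),
        zero_smul]
    rw [e3, ← integral_subtype measurableSet_Icc fun x => η x * F x]
    exact e2

lemma P1.weakDeriv_spec (v : P1) : IsWeakDeriv v.toC v.weakDeriv := v.exists_weakDeriv.choose_spec

lemma P1.weakDeriv_eq {v : P1} {g : L2I} (h : IsWeakDeriv v.toC g) : v.weakDeriv = g :=
  v.weakDeriv_spec.unique h

/-- The normalization of a positive Neumann test function. -/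
def IsNeumannTest.normalize {φ φ₁ φ₂ : ℝ → ℝ} (h : IsNeumannTest φ φ₁ φ₂) (hpos : ∀ x : I, 0 < φ x) :
    P1 where
  toC := ((∫ x : I, φ x)⁻¹ • h.toC : C(I, ℝ))
  exists_weakDeriv := ⟨_, (h.const_mul (∫ x : I, φ x)⁻¹).isWeakDeriv⟩
  pos x := mul_pos (inv_pos.2 (ContinuousMap.integral_pos_unitInterval (g := h.toC)
    (fun y => (hpos y).le) (hpos 0).ne')) (hpos x)
  integral_eq_one := by
    have h0 : 0 < ∫ x : I, φ x := ContinuousMap.integral_pos_unitInterval (g := h.toC)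
      (fun y => (hpos y).le) (hpos 0).ne'
    simp only [ContinuousMap.smul_apply, h.toC_apply, smul_eq_mul, integral_const_mul]
    exact inv_mul_cancel₀ h0.ne'

lemma IsNeumannTest.weakDeriv_normalize {φ φ₁ φ₂ : ℝ → ℝ} (h : IsNeumannTest φ φ₁ φ₂)
    (hpos : ∀ x : I, 0 < φ x) :
    (h.normalize hpos).weakDeriv = (∫ x : I, φ x)⁻¹ • classL2 h.derivC := by
  refine P1.weakDeriv_eq ?_
  have := (h.const_mul (∫ x : I, φ x)⁻¹).isWeakDeriv
  rw [← map_smul]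
  exact this

lemma P1.continuous_toL2 : Continuous P1.toL2 := 
  continuous_fst.comp (continuous_induced_dom (f := fun v : P1 => (v.toL2, v.weakDeriv)))

lemma P1.toL2_injective : Function.Injective P1.toL2 := fun _ _ h =>
  P1.ext (ContinuousMap.toLp_injective (volume : Measure I) h)

lemma P1.inner_toL2_one (v : P1) : inner ℝ v.toL2 (classL2 1) = 1 := by
  rw [real_inner_comm, inner_classL2]
  refine Eq.trans ?_ v.integral_eq_one
  exact (integral_mul_classL2 _ v.toC).trans (by simp)

lemma integral_mul_eq_inner (f : L2I) (g : C(I, ℝ)) :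
    ∫ x : I, f x * g x = inner ℝ f (classL2 g) := by
  rw [real_inner_comm, inner_classL2]
  simp only [mul_comm]

/-! ### The normalized flow: existence, uniqueness, continuity -/

namespace IsNeumannEigenbasis

variable {V : C(I, ℝ)} {κ : ℕ → ℝ} {e : ℕ → ℝ → ℝ} (hV : ∀ x, 0 < V x)

/-- The pairing `⟨S(t) f, g⟩` with the linear heat semigroup `S`. -/
def pairing (he : IsNeumannEigenbasis V κ e) (f g : L2I) (t : ℝ) : ℝ :=
  ∑' n, Real.exp (-(κ n * t)) * (he.coord n f * he.coord n g)

lemma pairing_zero (he : IsNeumannEigenbasis V κ e) (f g : L2I) :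
    he.pairing f g 0 = inner ℝ f g := by
  simp [pairing, (he.hasSum_coord_mul f g).tsum_eq]

lemma pairing_eigenfunction (he : IsNeumannEigenbasis V κ e) (f : L2I) (n : ℕ) (t : ℝ) :
    he.pairing f (classL2 (he.eC n)) t = Real.exp (-(κ n * t)) * he.coord n f := by
  rw [pairing, tsum_eq_single n]
  · simp [coord_basis]
  · intro m hm
    simp [coord_basis, hm]

lemma pairing_neg_right (he : IsNeumannEigenbasis V κ e) (f g : L2I) (t : ℝ) :
    he.pairing f (-g) t = -he.pairing f g t := by
  simp [pairing, tsum_neg]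

include hV in
lemma exp_le_one (he : IsNeumannEigenbasis V κ e) (n : ℕ) {t : ℝ} (ht : 0 ≤ t) :
    Real.exp (-(κ n * t)) ≤ 1 := by
  rw [Real.exp_le_one_iff]
  have := mul_nonneg (he.eigenvalue_pos hV n).le ht
  linarith

include hV in
-- The Parseval series dominates uniformly down to time `0`, where the pointwise heat series may
-- fail to converge. For this reason the weak equation is handled through pairings.
lemma continuousOn_pairing (he : IsNeumannEigenbasis V κ e) (f g : L2I) :
    ContinuousOn (he.pairing f g) (Ici 0) := by
  refine continuousOn_tsum (fun n => by fun_prop) (he.hasSum_coord_mul f g).summable.norm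
    fun n t ht => ?_
  rw [norm_mul, Real.norm_of_nonneg (Real.exp_pos _).le]
  exact mul_le_of_le_one_left (norm_nonneg _) (he.exp_le_one hV n ht)

include hV in
/-- The semigroup solves the linear equation weakly. -/
lemma hasDerivWithinAt_pairing (he : IsNeumannEigenbasis V κ e) {φ φ₁ φ₂ : ℝ → ℝ}
    (h : IsNeumannTest φ φ₁ φ₂) (f : L2I) {t T : ℝ} (ht : t ∈ Icc 0 T) :
    HasDerivWithinAt (he.pairing f (classL2 h.toC)) (he.pairing f (classL2 (h.opC V)) t)
      (Icc 0 T) t := by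
  refine hasDerivWithinAt_tsum_Icc (he.hasSum_coord_mul f (classL2 (h.opC V))).summable.norm
    (f := fun n s => Real.exp (-(κ n * s)) * (he.coord n f * he.coord n (classL2 h.toC)))
    (f' := fun n s => Real.exp (-(κ n * s)) * (he.coord n f * he.coord n (classL2 (h.opC V))))
    (fun n s _ => ?_) (fun n => by fun_prop) (fun n s hs => ?_) ?_ ht
  · have := (((hasDerivAt_id s).const_mul (κ n)).fun_neg.exp).mul_const
      (he.coord n f * he.coord n (classL2 h.toC))
    refine this.hasDerivWithinAt.congr_deriv ?_
    rw [he.coord_opC h]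
    simp only [id]
    ring
  · rw [abs_mul, abs_of_pos (Real.exp_pos _)]
    exact mul_le_of_le_one_left (abs_nonneg _) (he.exp_le_one hV n hs.1)
  · simpa using (he.hasSum_coord_mul f (classL2 h.toC)).summable

include hV in
lemma inner_heat (he : IsNeumannEigenbasis V κ e) {t : ℝ} (ht : 0 < t) (f g : L2I) :
    inner ℝ (classL2 (he.heat t f)) g = he.pairing f g t := by
  rw [← (he.hasSum_coord_mul _ _).tsum_eq]
  exact tsum_congr fun n => by rw [he.coord_heat hV ht]; ring

/-- The total mass `∫ S(t) f` of the linear heat semigroup. -/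
def mass (he : IsNeumannEigenbasis V κ e) (f : L2I) (t : ℝ) : ℝ := he.pairing f (classL2 1) t

include hV in
lemma integral_heat (he : IsNeumannEigenbasis V κ e) {t : ℝ} (ht : 0 < t) (f : L2I) :
    ∫ x : I, he.heat t f x = he.mass f t := by
  rw [mass, ← he.inner_heat hV ht, inner_classL2, integral_mul_classL2]
  simp

include hV in
lemma mass_pos (he : IsNeumannEigenbasis V κ e) (v : P1) {t : ℝ} (ht : 0 ≤ t) :
    0 < he.mass v.toL2 t := by
  rcases ht.eq_or_lt with rfl | ht
  · rw [mass, pairing_zero, v.inner_toL2_one]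
    exact one_pos
  · rw [← he.integral_heat hV ht]
    exact ContinuousMap.integral_pos_unitInterval (fun x => (he.heat_pos hV v ht x).le)
      (x₀ := 0) (he.heat_pos hV v ht 0).ne'

include hV in
lemma toC_heat_test (he : IsNeumannEigenbasis V κ e) {t : ℝ} (ht : 0 < t) (f : L2I) :
    (he.heat_test hV ht f).toC = he.heat t f := by
  ext x
  rw [he.heat_apply hV ht, IsNeumannTest.toC_apply]

include hV in
lemma derivC_heat_test (he : IsNeumannEigenbasis V κ e) {t : ℝ} (ht : 0 < t) (f : L2I) :
    (he.heat_test hV ht f).derivC = he.heatDeriv t f := by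
  ext x
  rw [he.heatDeriv_apply hV ht, IsNeumannTest.derivC_apply]

/-- The normalized heat flow, which solves the nonlinear equation. -/
def sol (he : IsNeumannEigenbasis V κ e) (hV : ∀ x, 0 < V x) (t : ℝ) (v : P1) : P1 :=
  if ht : 0 < t then (he.heat_test hV ht v.toL2).normalize fun x => by
    rw [← he.heat_apply hV ht]
    exact he.heat_pos hV v ht x
  else v

lemma toL2_sol (he : IsNeumannEigenbasis V κ e) {t : ℝ} (ht : 0 < t) (v : P1) :
    (he.sol hV t v).toL2 = (he.mass v.toL2 t)⁻¹ • classL2 (he.heat t v.toL2) := by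
  rw [sol, dif_pos ht, ← he.integral_heat hV ht, ← he.toC_heat_test hV ht, ← map_smul]
  rfl

lemma weakDeriv_sol (he : IsNeumannEigenbasis V κ e) {t : ℝ} (ht : 0 < t) (v : P1) :
    (he.sol hV t v).weakDeriv = (he.mass v.toL2 t)⁻¹ • classL2 (he.heatDeriv t v.toL2) := by
  rw [sol, dif_pos ht, IsNeumannTest.weakDeriv_normalize, ← he.integral_heat hV ht,
    ← he.derivC_heat_test hV ht, ← he.toC_heat_test hV ht]
  rfl

lemma sol_zero (he : IsNeumannEigenbasis V κ e) (v : P1) : he.sol hV 0 v = v := by simp [sol]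

lemma inner_sol (he : IsNeumannEigenbasis V κ e) {t : ℝ} (ht : 0 ≤ t) (v : P1) (g : L2I) :
    inner ℝ (he.sol hV t v).toL2 g = (he.mass v.toL2 t)⁻¹ * he.pairing v.toL2 g t := by
  rcases ht.eq_or_lt with rfl | ht
  · rw [sol_zero, mass, pairing_zero, pairing_zero, v.inner_toL2_one, inv_one, one_mul]
  · rw [he.toL2_sol hV ht, real_inner_smul_left, he.inner_heat hV ht]

lemma coord_sol (he : IsNeumannEigenbasis V κ e) {t : ℝ} (ht : 0 ≤ t) (v : P1) (n : ℕ) :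
    he.coord n (he.sol hV t v).toL2
      = (he.mass v.toL2 t)⁻¹ * (Real.exp (-(κ n * t)) * he.coord n v.toL2) := by
  have h1 : he.coord n (he.sol hV t v).toL2 = inner ℝ (he.sol hV t v).toL2 (classL2 (he.eC n)) := by
    rw [real_inner_comm, inner_classL2, coord_apply]
    rfl
  rw [h1, he.inner_sol hV ht, pairing_eigenfunction]

/-- By `⟨S(t)f, S(s)f⟩ = ⟨S(t+s)f, f⟩`, the squared distance expands into masses and pairings, so
scalar continuity suffices. -/
lemma continuousOn_sol (he : IsNeumannEigenbasis V κ e) (v : P1) :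
    ContinuousOn (fun t => (he.sol hV t v).toL2) (Ici 0) := by
  intro s hs
  have hs' : (0 : ℝ) ≤ s := hs
  set f := v.toL2 with hf
  have hm : ContinuousWithinAt (he.mass f) (Ici 0) s := he.continuousOn_pairing hV f _ s hs
  have hm0 := (he.mass_pos hV v hs').ne'
  have hpair : ∀ {t r : ℝ}, 0 ≤ t → 0 ≤ r →
      he.pairing f (he.sol hV r v).toL2 t = (he.mass f r)⁻¹ * he.pairing f f (t + r) := by
    intro t r ht hr
    rw [pairing, pairing, ← tsum_mul_left]
    refine tsum_congr fun n => ?_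
    rw [he.coord_sol hV hr, mul_add, neg_add, Real.exp_add]
    ring
  have hnorm : ∀ t, 0 ≤ t → ‖(he.sol hV t v).toL2 - (he.sol hV s v).toL2‖ ^ 2
      = (he.mass f t)⁻¹ * ((he.mass f t)⁻¹ * he.pairing f f (t + t))
        - 2 * ((he.mass f t)⁻¹ * ((he.mass f s)⁻¹ * he.pairing f f (t + s)))
        + (he.mass f s)⁻¹ * ((he.mass f s)⁻¹ * he.pairing f f (s + s)) := by
    intro t ht
    rw [norm_sub_sq_real, ← real_inner_self_eq_norm_sq, ← real_inner_self_eq_norm_sq,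
      he.inner_sol hV ht, he.inner_sol hV ht, he.inner_sol hV hs', hpair ht ht, hpair ht hs',
      hpair hs' hs']
  have hp : ∀ g : ℝ → ℝ, ContinuousWithinAt g (Ici 0) s → (∀ t, 0 ≤ t → 0 ≤ g t) →
      ContinuousWithinAt (fun t => he.pairing f f (g t)) (Ici 0) s := fun g hg hg0 =>
    ContinuousWithinAt.comp (t := Ici 0) (he.continuousOn_pairing hV f f (g s) (hg0 s hs')) hg
      fun t ht => hg0 t ht
  have hc : ContinuousWithinAt (fun t =>
      (he.mass f t)⁻¹ * ((he.mass f t)⁻¹ * he.pairing f f (t + t))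
        - 2 * ((he.mass f t)⁻¹ * ((he.mass f s)⁻¹ * he.pairing f f (t + s)))
        + (he.mass f s)⁻¹ * ((he.mass f s)⁻¹ * he.pairing f f (s + s))) (Ici 0) s := by
    have h1 := hp (fun t => t + t) (by fun_prop) fun t ht => add_nonneg ht ht
    have h2 := hp (fun t => t + s) (by fun_prop) fun t ht => add_nonneg ht hs'
    have hi := hm.inv₀ hm0
    exact ((hi.mul (hi.mul h1)).sub (continuousWithinAt_const.mul
      (hi.mul (continuousWithinAt_const.mul h2)))).add continuousWithinAt_const
  have h0 : Tendsto (fun t => ‖(he.sol hV t v).toL2 - (he.sol hV s v).toL2‖ ^ 2) (𝓝[Ici 0] s)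
      (𝓝 0) := by
    have h3 := hc.tendsto
    rw [← hnorm s hs', sub_self, norm_zero, zero_pow two_ne_zero] at h3
    refine h3.congr' ?_
    filter_upwards [self_mem_nhdsWithin] with t ht using (hnorm t ht).symm
  rw [ContinuousWithinAt, tendsto_iff_norm_sub_tendsto_zero]
  have h4 := (Real.continuous_sqrt.tendsto 0).comp h0
  rw [Real.sqrt_zero] at h4
  exact h4.congr fun t => Real.sqrt_sq (norm_nonneg _)

lemma pairing_opC_one (he : IsNeumannEigenbasis V κ e) (f : L2I) (t : ℝ) :
    he.pairing f (classL2 ((IsNeumannTest.const 1).opC V)) t = -he.pairing f (classL2 V) t := by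
  rw [← pairing_neg_right, ← map_neg]
  congr 2
  ext x
  simp

include hV in
-- The constant `1` is a Neumann test function with `A 1 = -V`.
lemma hasDerivWithinAt_mass (he : IsNeumannEigenbasis V κ e) (f : L2I) {t T : ℝ}
    (ht : t ∈ Icc 0 T) :
    HasDerivWithinAt (he.mass f) (-he.pairing f (classL2 V) t) (Icc 0 T) t := by
  rw [← pairing_opC_one]
  exact he.hasDerivWithinAt_pairing hV (IsNeumannTest.const 1) f ht

/-- The normalized heat flow is a weak solution of the nonlinear equation. -/
lemma isWeakSolution_sol (he : IsNeumannEigenbasis V κ e) (v : P1) (T : ℝ) :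
    IsWeakSolution V T v.toL2 (fun t => (he.sol hV t v).toL2) where
  continuousOn := (he.continuousOn_sol hV v).mono fun _ ht => ht.1
  initial := by rw [sol_zero]
  weak_eq φ φ₁ φ₂ h t ht := by
    have hm0 := (he.mass_pos hV v ht.1).ne'
    have e1 : ∀ s ∈ Icc 0 T, ∫ x : I, (he.sol hV s v).toL2 x * φ x
        = (he.mass v.toL2 s)⁻¹ * he.pairing v.toL2 (classL2 h.toC) s := fun s hs => by
      rw [← he.inner_sol hV hs.1, ← integral_mul_eq_inner]
      rfl
    have e2 : ∫ x : I, (he.sol hV t v).toL2 x * (φ₂ x - V x * φ x)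
        = (he.mass v.toL2 t)⁻¹ * he.pairing v.toL2 (classL2 (h.opC V)) t := by
      rw [← he.inner_sol hV ht.1, ← integral_mul_eq_inner]
      rfl
    have e3 : ∫ y : I, V y * (he.sol hV t v).toL2 y
        = (he.mass v.toL2 t)⁻¹ * he.pairing v.toL2 (classL2 V) t := by
      rw [← he.inner_sol hV ht.1, ← inner_classL2, real_inner_comm]
    -- Differentiating the inverse mass is what creates the nonlocal term.
    have hd := ((he.hasDerivWithinAt_mass hV v.toL2 ht).fun_inv hm0).fun_mul
      (he.hasDerivWithinAt_pairing hV h v.toL2 ht)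
    refine (hd.congr e1 (e1 t ht)).congr_deriv ?_
    rw [e2, e3, e1 t ht]
    field_simp
    ring

/-- Uniqueness of weak solutions. -/
lemma eq_sol_of_isWeakSolution (he : IsNeumannEigenbasis V κ e) (v : P1) {T : ℝ} {u : ℝ → L2I}
    (hu : IsWeakSolution V T v.toL2 u) {t : ℝ} (ht : t ∈ Icc 0 T) :
    u t = (he.sol hV t v).toL2 := by
  have hT : 0 ≤ T := ht.1.trans ht.2
  set ρ : ℝ → ℝ := fun s => ∫ y : I, V y * u s y with hρ
  have hρc : ContinuousOn ρ (Icc 0 T) := by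
    have : ρ = fun s => innerSL ℝ (classL2 V) (u s) := by
      funext s
      rw [innerSL_apply_apply, inner_classL2]
    rw [this]
    exact (innerSL ℝ (classL2 V)).continuous.comp_continuousOn hu.continuousOn
  set r : ℝ → ℝ := IccExtend hT ((Icc 0 T).domRestrict ρ) with hr
  have hrc : Continuous r := (continuousOn_iff_continuous_domRestrict.1 hρc).Icc_extend'
  have hrρ : ∀ s ∈ Icc 0 T, r s = ρ s := fun s hs => by
    simp [hr, IccExtend_of_mem hT _ hs, domRestrict_apply]
  set P : ℝ → ℝ := fun s => ∫ z in (0 : ℝ)..s, r z with hP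
  have hPd : ∀ s ∈ Icc 0 T, HasDerivWithinAt P (ρ s) (Icc 0 T) s := fun s hs => by
    rw [← hrρ s hs]
    exact (hrc.integral_hasStrictDerivAt 0 s).hasDerivAt.hasDerivWithinAt
  -- integrating factor
  have factor : ∀ (a : ℝ → ℝ) (μ : ℝ),
      (∀ s ∈ Icc 0 T, HasDerivWithinAt a ((-μ + ρ s) * a s) (Icc 0 T) s) →
      a t = a 0 * Real.exp (-(μ * t)) * Real.exp (P t) := by
    intro a μ ha
    have hd : ∀ s ∈ Icc 0 T, HasDerivWithinAt (fun s => a s * Real.exp (μ * s - P s)) 0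
        (Icc 0 T) s := fun s hs => by
      refine ((ha s hs).fun_mul ((((hasDerivAt_id s).const_mul μ).hasDerivWithinAt.fun_sub
        (hPd s hs)).exp)).congr_deriv ?_
      simp only [id]
      ring
    have hconst := constant_of_has_deriv_right_zero (fun s hs => (hd s hs).continuousWithinAt)
      (fun s hs => (hd s ⟨hs.1, hs.2.le⟩).mono_of_mem_nhdsWithin (Icc_mem_nhdsGE_of_mem hs)) t ht
    simp only [hP, intervalIntegral.integral_same, mul_zero, sub_zero, Real.exp_zero,
      mul_one] at hconst
    rw [← hconst, mul_assoc, mul_assoc, ← Real.exp_add, ← Real.exp_add]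
    have : μ * t - (∫ z in (0 : ℝ)..t, r z) + (-(μ * t) + ∫ z in (0 : ℝ)..t, r z) = 0 := by ring
    rw [this, Real.exp_zero, mul_one]
  have hcoord : ∀ n, he.coord n (u t)
      = Real.exp (P t) * (Real.exp (-(κ n * t)) * he.coord n v.toL2) := by
    intro n
    have hi : ∀ s, he.coord n (u s) = ∫ x : I, u s x * e n x := fun s => by
      rw [coord_apply]
      simp only [mul_comm]
    have h1 := factor (fun s => he.coord n (u s)) (κ n) fun s hs => by
      simp only [hi]
      refine (hu.weak_eq _ _ _ (he.test n) s hs).congr_deriv ?_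
      have : ∫ x : I, u s x * ((extendPotential V x - κ n) * e n x - V x * e n x)
          = -κ n * ∫ x : I, u s x * e n x := by
        rw [← integral_const_mul]
        exact integral_congr_ae (ae_of_all _ fun x => by simp only [extendPotential_coe]; ring)
      rw [this]
      ring
    rw [h1, hu.initial]
    ring
  -- The mass defect solves `a' = ρ a` with `a(0) = 0`, so mass conservation need not be assumed of
  -- `u`.
  have hone : inner ℝ (u t) (classL2 1) = 1 := by
    have hi : ∀ s, inner ℝ (u s) (classL2 1) = ∫ x : I, u s x * 1 := fun s => by
      rw [← integral_mul_eq_inner]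
      rfl
    have h1 := factor (fun s => inner ℝ (u s) (classL2 1) - 1) 0 fun s hs => by
      simp only [hi]
      refine ((hu.weak_eq _ _ _ (IsNeumannTest.const 1) s hs).sub_const 1).congr_deriv ?_
      have : ∫ x : I, u s x * (0 - V x * 1) = -ρ s := by
        rw [hρ, ← integral_neg]
        exact integral_congr_ae (ae_of_all _ fun x => by simp only; ring)
      rw [this]
      ring
    rw [hu.initial, v.inner_toL2_one, sub_self, zero_mul, zero_mul] at h1
    linarith
  -- Unit mass, expanded by Parseval, identifies the unknown factor as the inverse mass of the
  -- linear flow.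
  have hmass : Real.exp (P t) * he.mass v.toL2 t = 1 := by
    rw [← hone, ← (he.hasSum_coord_mul _ _).tsum_eq, mass, pairing, ← tsum_mul_left]
    exact tsum_congr fun n => by rw [hcoord]; ring
  refine he.ext_coord fun n => ?_
  rw [hcoord, he.coord_sol hV ht.1, eq_inv_of_mul_eq_one_left hmass]

/-- Existence selects the first branch of the definition; uniqueness makes the chosen value
irrelevant. -/
lemma nonlinearHeatFlow_eq (he : IsNeumannEigenbasis V κ e) {t : ℝ} (ht : 0 ≤ t) (v : P1) :
    nonlinearHeatFlow V t v = he.sol hV t v := by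
  have h : ∃ w : P1, ∃ u : ℝ → L2I, IsWeakSolution V t v.toL2 u ∧ u t = w.toL2 :=
    ⟨he.sol hV t v, _, he.isWeakSolution_sol hV v t, rfl⟩
  rw [nonlinearHeatFlow, dif_pos h]
  obtain ⟨u, hu, hut⟩ := h.choose_spec
  exact P1.toL2_injective (hut.symm.trans (he.eq_sol_of_isWeakSolution hV v hu ⟨ht, le_rfl⟩))

/-- For `t > 0` both `heat` and `heatDeriv` are bounded from `L²` to `C(I, ℝ)`, so `L²` continuity
in the datum already gives `H¹` continuity of the value. -/
lemma continuous_sol (he : IsNeumannEigenbasis V κ e) {t : ℝ} (ht : 0 ≤ t) :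
    Continuous (he.sol hV t) := by
  rcases ht.eq_or_lt with rfl | ht
  · exact continuous_id.congr fun v => (he.sol_zero hV v).symm
  have hT : Continuous fun v : P1 => he.heat t v.toL2 :=
    (he.heat t).continuous.comp P1.continuous_toL2
  have hD : Continuous fun v : P1 => he.heatDeriv t v.toL2 :=
    (he.heatDeriv t).continuous.comp P1.continuous_toL2
  have hm : Continuous fun v : P1 => he.mass v.toL2 t := by
    have : (fun v : P1 => he.mass v.toL2 t)
        = fun v : P1 => inner ℝ (classL2 (he.heat t v.toL2)) (classL2 1) := by
      funext v
      rw [he.inner_heat hV ht, mass]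
    rw [this]
    exact (classL2.continuous.comp hT).inner continuous_const
  have hi : Continuous fun v : P1 => (he.mass v.toL2 t)⁻¹ :=
    hm.inv₀ fun v => (he.mass_pos hV v ht.le).ne'
  refine continuous_induced_rng.2 ?_
  refine Continuous.congr (f := fun v : P1 =>
    ((he.mass v.toL2 t)⁻¹ • classL2 (he.heat t v.toL2),
      (he.mass v.toL2 t)⁻¹ • classL2 (he.heatDeriv t v.toL2)))
    ((hi.smul (classL2.continuous.comp hT)).prodMk (hi.smul (classL2.continuous.comp hD)))
    fun v => ?_
  simp only [Function.comp_apply, he.toL2_sol hV ht, he.weakDeriv_sol hV ht]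

/-! ### Nonvanishing and the eigenfunctionals -/

/-- The coefficients of finitely many eigenfunctions are simultaneously nonzero at some point. -/
lemma exists_coeff_ne_zero (he : IsNeumannEigenbasis V κ e) (S : Finset ℕ) :
    ∃ v : P1, ∀ n ∈ S, coeff e n v ≠ 0 := by
  set g : C(I, ℝ) := ∑ n ∈ S, he.eC n with hg
  -- The witness is `1 + s g`, normalized. Small `s` keeps it positive; its `n`-th coefficient is
  -- proportional to `∫ e n + s`, so only finitely many `s` are excluded.
  have hinf : (Ioo (0 : ℝ) (1 / (‖g‖ + 1)) \ ((S.image fun n => -∫ x : I, e n x : Finset ℝ) :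
      Set ℝ)).Nonempty := by
    refine ((Ioo_infinite ?_).sdiff (Finset.finite_toSet _)).nonempty
    positivity
  obtain ⟨s, hs, hsS⟩ := hinf
  have h := (IsNeumannTest.const 1).add
    ((IsNeumannTest.sum S he.test).const_mul s)
  have hsum : ∀ x : I, ∑ n ∈ S, e n x = g x := fun x => by
    simp [hg, ContinuousMap.sum_apply]
  have hpos : ∀ x : I, 0 < 1 + s * ∑ n ∈ S, e n x := fun x => by
    rw [hsum]
    have h1 := neg_le_of_abs_le (g.norm_coe_le_norm x)
    have h2 : s * (‖g‖ + 1) < 1 := (lt_div_iff₀ (by positivity)).1 hs.2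
    nlinarith [hs.1]
  refine ⟨h.normalize hpos, fun n hn => ?_⟩
  rw [← he.coord_toL2]
  have h0 : 0 < ∫ x : I, (1 + s * ∑ n ∈ S, e n x) :=
    ContinuousMap.integral_pos_unitInterval (g := h.toC) (fun y => (hpos y).le) (hpos 0).ne'
  have e1 : (h.normalize hpos).toL2
      = (∫ x : I, (1 + s * ∑ n ∈ S, e n x))⁻¹ • (classL2 1 + s • ∑ n ∈ S, classL2 (he.eC n)) := by
    rw [← map_sum, ← map_smul, ← map_add, ← map_smul]
    change classL2 _ = classL2 _
    congr 1
    ext x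
    change (∫ x : I, (1 + s * ∑ n ∈ S, e n x))⁻¹ * (1 + s * ∑ n ∈ S, e n x) = _
    simp only [ContinuousMap.smul_apply, ContinuousMap.add_apply, ContinuousMap.one_apply,
      ContinuousMap.sum_apply, eC_apply, smul_eq_mul]
  have e2 : he.coord n (classL2 1) = ∫ x : I, e n x := by
    rw [coord_classL2]
    simp
  rw [e1, map_smul, map_add, map_smul, map_sum]
  simp only [coord_basis, Finset.sum_ite_eq, hn, if_true, smul_eq_mul, mul_one, e2]
  refine mul_ne_zero (inv_ne_zero h0.ne') fun h3 => hsS ?_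
  rw [Finset.mem_coe, Finset.mem_image]
  exact ⟨n, hn, by linarith⟩

lemma continuous_coeff (he : IsNeumannEigenbasis V κ e) (n : ℕ) : Continuous (coeff e n) :=
  ((he.coord n).continuous.comp P1.continuous_toL2).congr fun v => he.coord_toL2 n v

include hV in
-- The inverse mass multiplies all coefficients alike and cancels in the quotient.
lemma coeff_flow_div (he : IsNeumannEigenbasis V κ e) {t : ℝ} (ht : 0 ≤ t) (v : P1) (q : ℕ) :
    coeff e q (nonlinearHeatFlow V t v) / coeff e 0 (nonlinearHeatFlow V t v)
      = Real.exp (-((κ q - κ 0) * t)) * (coeff e q v / coeff e 0 v) := by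
  have hm := (he.mass_pos hV v ht).ne'
  have h0 := (he.coeff_zero_pos hV v).ne'
  rw [he.nonlinearHeatFlow_eq hV ht, ← he.coord_toL2, ← he.coord_toL2, he.coord_sol hV ht,
    he.coord_sol hV ht, he.coord_toL2, he.coord_toL2,
    show -((κ q - κ 0) * t) = -(κ q * t) - -(κ 0 * t) by ring, Real.exp_sub]
  field_simp

include hV in
lemma isKoopmanEigenfunctional_psi (he : IsNeumannEigenbasis V κ e) {m : ℕ} (ν : Fin (m + 1) → ℕ) :
    IsKoopmanEigenfunctional V (rateOf κ ν) (psi e ν) := by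
  refine ⟨?_, fun t ht => Module.End.hasEigenvector_iff.2 ⟨?_, ?_⟩⟩
  · exact continuous_finsetProd _ fun i _ => (he.continuous_coeff _).div (he.continuous_coeff 0)
      fun v => (he.coeff_zero_pos hV v).ne'
  · rw [Module.End.mem_eigenspace_iff]
    funext v
    change psi e ν (nonlinearHeatFlow V t v) = Real.exp (-(rateOf κ ν * t)) * psi e ν v
    simp only [psi, he.coeff_flow_div hV ht, Finset.prod_mul_distrib, ← Real.exp_sum, rateOf,
      Finset.sum_mul, Finset.sum_neg_distrib]
  · obtain ⟨v, hv⟩ := he.exists_coeff_ne_zero (Finset.univ.image ν)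
    intro h
    have h1 : psi e ν v = 0 := congrFun h v
    refine Finset.prod_ne_zero_iff.2 (fun i _ => ?_) h1
    exact div_ne_zero (hv _ (Finset.mem_image_of_mem _ (Finset.mem_univ i)))
      (he.coeff_zero_pos hV v).ne'

end IsNeumannEigenbasis

end

theorem mainTheorem10 (V : C(I, ℝ)) (hV : ∀ x : I, 0 < V x)
    (κ : ℕ → ℝ) (e : ℕ → ℝ → ℝ) (he : IsNeumannEigenbasis V κ e) :
    -- the flow on `𝒫₁` exists for all times and gives the only weak solution
    (∀ (v₀ : P1) (T : ℝ), 0 ≤ T →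
      IsWeakSolution V T v₀.toL2 (fun t => (nonlinearHeatFlow V t v₀).toL2) ∧
      ∀ u : ℝ → L2I, IsWeakSolution V T v₀.toL2 u →
        ∀ t ∈ Icc (0 : ℝ) T, u t = (nonlinearHeatFlow V t v₀).toL2) ∧
    -- the Koopman operators act on the observables
    (∀ t : ℝ, 0 ≤ t → ∀ ϕ ∈ observables, koopman V t ϕ ∈ observables) ∧
    -- the denominators do not vanish
    (∀ v : P1, 0 < coeff e 0 v) ∧
    -- eigenfunctionals `c_q / c_0`
    (∀ q : ℕ, IsKoopmanEigenfunctional V (κ q - κ 0) (fun v => coeff e q v / coeff e 0 v)) ∧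
    -- eigenfunctionals `ψ_ν`, `ν = (q_0, …, q_m)` with `q_1, …, q_m` nonzero
    (∀ (m : ℕ) (ν : Fin (m + 1) → ℕ), (∀ i, i ≠ 0 → ν i ≠ 0) →
      IsKoopmanEigenfunctional V (rateOf κ ν) (psi e ν)) := by
  refine ⟨fun v₀ T hT => ⟨?_, fun u hu t ht => ?_⟩, fun t ht ϕ hϕ => ?_, he.coeff_zero_pos hV,
    fun q => ?_, fun m ν _ => he.isKoopmanEigenfunctional_psi hV ν⟩
  · have h := he.isWeakSolution_sol hV v₀ T
    have heq : ∀ t ∈ Icc (0 : ℝ) T,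
        (nonlinearHeatFlow V t v₀).toL2 = (he.sol hV t v₀).toL2 := fun t ht => by
      rw [he.nonlinearHeatFlow_eq hV ht.1]
    refine ⟨h.continuousOn.congr heq, (heq 0 ⟨le_rfl, hT⟩).trans h.initial,
      fun φ φ₁ φ₂ hφ t ht => ?_⟩
    rw [heq t ht]
    exact (h.weak_eq φ φ₁ φ₂ hφ t ht).congr (fun s hs => by rw [heq s hs]) (by rw [heq t ht])
  · rw [he.nonlinearHeatFlow_eq hV ht.1]
    exact he.eq_sol_of_isWeakSolution hV v₀ hu ht
  · exact (hϕ.comp (he.continuous_sol hV ht)).congr fun v =>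
      congrArg ϕ (he.nonlinearHeatFlow_eq hV ht v).symm
  · have h := he.isKoopmanEigenfunctional_psi hV (m := 0) fun _ => q
    have h1 : psi e (fun _ : Fin 1 => q) = fun v => coeff e q v / coeff e 0 v := by
      funext v
      simp [psi]
    have h2 : rateOf κ (fun _ : Fin 1 => q) = κ q - κ 0 := by simp [rateOf]
    rwa [h1, h2] at h
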